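/- For complex $q$ with $|q|<1$ put $(x;q)_n=\prod_{i=0}^{n-1}(1-xq^i)$ and $(x_1,\dots,x_r;q)_n=(x_1;q)_n\cdots(x_r;q)_n$, and let $$a(q)=\sum_{m,n=-\infty}^{\infty}q^{m^2+mn+n^2}$$ be the Borwein cubic theta series. Let $0<|q|<1$, and let $\rho_1,\rho_2$ be non-zero complex numbers such that no denominator below vanishes, i.e. $\rho_1\ne q^{3j+2}$, $\rho_2\neq q^{3j+2}$ and $\rho_1\rho_2q^{3j+1}\ne 1$ for all integers $j\ge 0$. Then the following series all converge absolutely, and $$\begin{aligned} a(q)&=1+6\sum_{n=1}^\infty\frac{(q;q^3)_n\,q^n}{(q^2;q^3)_n(1-q^{3n})}\\ &=1-6\sum_{n=1}^\infty\frac{(1-q^{6n-1})(1/q,1/q;q^3)_n(q^3;q^3)_{2n-1}\,q^{2n}}{(1-1/q)(q^3,q^3;q^3)_n(q;q^3)_{2n}}\\ &=1+6\sum_{n=1}^\infty\frac{(\rho_1q,\rho_2q,q^2/(\rho_1\rho_2);q^3)_n\,q^n}{(q^2/\rho_1,q^2/\rho_2,\rho_1\rho_2q;q^3)_n(1-q^{3n})}\\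 &\quad-6\sum_{n=1}^\infty\frac{(1-q^{6n-1})(1/q,\rho_1,\rho_2,q/(\rho_1\rho_2);q^3)_n(q^3;q^3)_{2n-1}\,q^{2n}}{(1-1/q)(q^2/\rho_1,q^2/\rho_2,\rho_1\rho_2q,q^3;q^3)_n(q;q^3)_{2n}}\\ &=1+6\sum_{n=1}^\infty\frac{(-1)^nq^{(3n^2+n)/2}}{1-q^{3n}}\\ &\quad-6\sum_{n=1}^\infty\frac{(1-q^{6n-1})(1/q;q^3)_n(q^3;q^3)_{2n-1}(-1)^nq^{(3n^2-n)/2}}{(1-1/q)(q^3;q^3)_n(q;q^3)_{2n}}. \end{aligned}$$ The conditions on $\rho_1,\rho_2$ concern only the third representation. -/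

import Mathlib

/-- The finite `q`-shifted factorial `(a; q)_n = (1 - a)(1 - a q) ⋯ (1 - a q ^ (n - 1))`. -/
def qPoch (a q : ℂ) (n : ℕ) : ℂ := ∏ i ∈ Finset.range n, (1 - a * q ^ i)

/-- The term `q ^ (m² + m n + n²)` of the cubic theta series; the integer exponent is
nonnegative. -/
noncomputable def cubicThetaTerm (q : ℂ) (p : ℤ × ℤ) : ℂ :=
  q ^ (p.1 ^ 2 + p.1 * p.2 + p.2 ^ 2)

/-- The Borwein cubic theta series `a(q) = ∑_{m, n ∈ ℤ} q ^ (m² + m n + n²)`. -/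
noncomputable def cubicTheta (q : ℂ) : ℂ := ∑' p : ℤ × ℤ, cubicThetaTerm q p

/-- `(q; q³)_n q^n / ((q²; q³)_n (1 - q^{3n}))`. -/
noncomputable def seriesOne (q : ℂ) (n : ℕ+) : ℂ :=
  qPoch q (q ^ 3) n * q ^ (n : ℕ) / (qPoch (q ^ 2) (q ^ 3) n * (1 - q ^ (3 * (n : ℕ))))

/-- `(1 - q^{6n-1}) (1/q, 1/q; q³)_n (q³; q³)_{2n-1} q^{2n}
  / ((1 - 1/q) (q³, q³; q³)_n (q; q³)_{2n})`. -/
noncomputable def seriesTwo (q : ℂ) (n : ℕ+) : ℂ :=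
  (1 - q ^ (6 * (n : ℕ) - 1)) * (qPoch (1 / q) (q ^ 3) n * qPoch (1 / q) (q ^ 3) n)
      * qPoch (q ^ 3) (q ^ 3) (2 * (n : ℕ) - 1) * q ^ (2 * (n : ℕ))
    / ((1 - 1 / q) * (qPoch (q ^ 3) (q ^ 3) n * qPoch (q ^ 3) (q ^ 3) n)
      * qPoch q (q ^ 3) (2 * (n : ℕ)))

/-- `(ρ₁ q, ρ₂ q, q²/(ρ₁ρ₂); q³)_n q^n / ((q²/ρ₁, q²/ρ₂, ρ₁ρ₂ q; q³)_n (1 - q^{3n}))`. -/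
noncomputable def seriesThreeFst (q ρ₁ ρ₂ : ℂ) (n : ℕ+) : ℂ :=
  qPoch (ρ₁ * q) (q ^ 3) n * qPoch (ρ₂ * q) (q ^ 3) n * qPoch (q ^ 2 / (ρ₁ * ρ₂)) (q ^ 3) n
      * q ^ (n : ℕ)
    / (qPoch (q ^ 2 / ρ₁) (q ^ 3) n * qPoch (q ^ 2 / ρ₂) (q ^ 3) n
      * qPoch (ρ₁ * ρ₂ * q) (q ^ 3) n * (1 - q ^ (3 * (n : ℕ))))

/-- `(1 - q^{6n-1}) (1/q, ρ₁, ρ₂, q/(ρ₁ρ₂); q³)_n (q³; q³)_{2n-1} q^{2n}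
  / ((1 - 1/q) (q²/ρ₁, q²/ρ₂, ρ₁ρ₂ q, q³; q³)_n (q; q³)_{2n})`. -/
noncomputable def seriesThreeSnd (q ρ₁ ρ₂ : ℂ) (n : ℕ+) : ℂ :=
  (1 - q ^ (6 * (n : ℕ) - 1))
      * (qPoch (1 / q) (q ^ 3) n * qPoch ρ₁ (q ^ 3) n * qPoch ρ₂ (q ^ 3) n
        * qPoch (q / (ρ₁ * ρ₂)) (q ^ 3) n)
      * qPoch (q ^ 3) (q ^ 3) (2 * (n : ℕ) - 1) * q ^ (2 * (n : ℕ))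
    / ((1 - 1 / q)
      * (qPoch (q ^ 2 / ρ₁) (q ^ 3) n * qPoch (q ^ 2 / ρ₂) (q ^ 3) n
        * qPoch (ρ₁ * ρ₂ * q) (q ^ 3) n * qPoch (q ^ 3) (q ^ 3) n)
      * qPoch q (q ^ 3) (2 * (n : ℕ)))

/-- `(-1)^n q^{(3n²+n)/2} / (1 - q^{3n})`; the exponent `(3n²+n)/2` is an integer. -/
noncomputable def seriesFourFst (q : ℂ) (n : ℕ+) : ℂ :=
  (-1) ^ (n : ℕ) * q ^ ((3 * (n : ℕ) ^ 2 + n) / 2) / (1 - q ^ (3 * (n : ℕ)))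

/-- `(1 - q^{6n-1}) (1/q; q³)_n (q³; q³)_{2n-1} (-1)^n q^{(3n²-n)/2}
  / ((1 - 1/q) (q³; q³)_n (q; q³)_{2n})`; the exponent `(3n²-n)/2` is a natural number. -/
noncomputable def seriesFourSnd (q : ℂ) (n : ℕ+) : ℂ :=
  (1 - q ^ (6 * (n : ℕ) - 1)) * qPoch (1 / q) (q ^ 3) n
      * qPoch (q ^ 3) (q ^ 3) (2 * (n : ℕ) - 1) * (-1) ^ (n : ℕ) * q ^ ((3 * (n : ℕ) ^ 2 - n) / 2)
    / ((1 - 1 / q) * qPoch (q ^ 3) (q ^ 3) n * qPoch q (q ^ 3) (2 * (n : ℕ)))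

/-!
Jackson's sum for a terminating very-well-poised `₈φ₇` with base point `a` and base `p` expresses a
quotient of shifted factorials of length `n` as a sum over `0 ≤ m ≤ n`. Multiply it by
`(a² p) ^ n / (1 - p ^ n)`, sum over `n ≥ 1` and exchange the summations: for `m ≥ 1` the sum over
`n` is a `q`-Gauss sum, while the row `m = 0` is the derivative of the `q`-Gauss sum at a point
where its value is `1`, hence the logarithmic derivative of an infinite product. For `a = 1 / q` and
`p = q³` that row is the Lambert series `∑ (q ^ (3i+1) / (1 - q ^ (3i+1)) -
q ^ (3i+2) / (1 - q ^ (3i+2)))`, which equals `(a(q) - 1) / 6`.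

The last equality comes from the cube of Jacobi's theta series in `z`. Its coefficients are
quasi-periodic with period `3`, so it is a combination of three theta series of base `q³`, with
`a(q)` as one of the coefficients. Putting `z` equal to a primitive cube root of unity determines
the other coefficient, and differentiating at `z = 1` yields `a(q)`.
-/

open Filter Topology Finset

section QPoch

variable {a q : ℂ}

theorem qPoch_zero (a q : ℂ) : qPoch a q 0 = 1 := by simp [qPoch]

theorem qPoch_succ (a q : ℂ) (n : ℕ) : qPoch a q (n + 1) = qPoch a q n * (1 - a * q ^ n) := by
  simp [qPoch, prod_range_succ]

theorem qPoch_add (a q : ℂ) (m n : ℕ) :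
    qPoch a q (m + n) = qPoch a q m * qPoch (a * q ^ m) q n := by
  simp only [qPoch, prod_range_add]
  congr 1
  exact prod_congr rfl fun i _ => by rw [pow_add]; ring

theorem qPoch_succ' (a q : ℂ) (n : ℕ) : qPoch a q (n + 1) = (1 - a) * qPoch (a * q) q n := by
  rw [add_comm, qPoch_add]
  simp [qPoch]

theorem qPoch_ne_zero (h : ∀ i : ℕ, 1 - a * q ^ i ≠ 0) (n : ℕ) : qPoch a q n ≠ 0 :=
  prod_ne_zero_iff.2 fun i _ => h i

theorem norm_pow_lt_one {n : ℕ} (hq : ‖q‖ < 1) (hn : n ≠ 0) : ‖q ^ n‖ < 1 := by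
  rw [norm_pow]
  exact pow_lt_one₀ (norm_nonneg q) hq hn

theorem norm_mul_pow_le (a : ℂ) (hq : ‖q‖ ≤ 1) (n : ℕ) : ‖a * q ^ n‖ ≤ ‖a‖ := by
  rw [norm_mul, norm_pow]
  exact mul_le_of_le_one_right (norm_nonneg a) (pow_le_one₀ (norm_nonneg q) hq)

theorem one_sub_mul_pow_ne_zero (ha : ‖a‖ < 1) (hq : ‖q‖ ≤ 1) (i : ℕ) : 1 - a * q ^ i ≠ 0 := by
  refine sub_ne_zero.2 fun h => ((norm_mul_pow_le a hq i).trans_lt ha).ne ?_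
  rw [← h, norm_one]

theorem qPoch_self_ne_zero (hq : ‖q‖ < 1) (n : ℕ) : qPoch q q n ≠ 0 :=
  qPoch_ne_zero (one_sub_mul_pow_ne_zero hq hq.le) n

theorem one_sub_pow_succ_ne_zero (hq : ‖q‖ < 1) (i : ℕ) : 1 - q ^ (i + 1) ≠ 0 := by
  rw [pow_succ']
  exact one_sub_mul_pow_ne_zero hq hq.le i

/-- The infinite `q`-shifted factorial `(a; q)_∞ = ∏_{i ≥ 0} (1 - a q ^ i)`, the limit of the
finite ones. -/
noncomputable def qPochInf (a q : ℂ) : ℂ := ∏' i : ℕ, (1 - a * q ^ i)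

theorem summable_norm_mul_pow (a : ℂ) (hq : ‖q‖ < 1) : Summable fun i : ℕ => ‖a * q ^ i‖ := by
  simp only [norm_mul, norm_pow]
  exact (summable_geometric_of_lt_one (norm_nonneg _) hq).mul_left _

theorem tendsto_qPoch (a : ℂ) (hq : ‖q‖ < 1) :
    Tendsto (qPoch a q) atTop (𝓝 (qPochInf a q)) := by
  have h : Multipliable fun i : ℕ => 1 - a * q ^ i := by
    simpa [sub_eq_add_neg] using multipliable_one_add_of_summable (f := fun i : ℕ => -(a * q ^ i))
      (by simpa using summable_norm_mul_pow a hq)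
  exact h.hasProd.tendsto_prod_nat

theorem qPochInf_ne_zero (hq : ‖q‖ < 1) (h : ∀ i : ℕ, 1 - a * q ^ i ≠ 0) :
    qPochInf a q ≠ 0 := by
  have := tprod_one_add_ne_zero_of_summable (f := fun i : ℕ => -(a * q ^ i))
    (by simpa [sub_eq_add_neg] using h) (by simpa using summable_norm_mul_pow a hq)
  simpa [qPochInf, sub_eq_add_neg] using this

theorem qPochInf_eq_mul (a : ℂ) (hq : ‖q‖ < 1) (n : ℕ) :
    qPochInf a q = qPoch a q n * qPochInf (a * q ^ n) q := by
  refine tendsto_nhds_unique ((tendsto_add_atTop_iff_nat n).2 (tendsto_qPoch a hq)) ?_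
  refine ((tendsto_qPoch (a * q ^ n) hq).const_mul (qPoch a q n)).congr fun m => ?_
  rw [← qPoch_add, add_comm]

theorem exists_norm_le_of_tendsto {f : ℕ → ℂ} {l : ℂ} (hf : Tendsto f atTop (𝓝 l)) :
    ∃ C : ℝ, 0 < C ∧ ∀ n, ‖f n‖ ≤ C := by
  obtain ⟨C, hC⟩ := (Metric.isBounded_range_of_tendsto _ hf).exists_norm_le
  exact ⟨max C 1, by positivity, fun n => (hC _ ⟨n, rfl⟩).trans (le_max_left _ _)⟩

theorem exists_norm_qPoch_le (a : ℂ) (hq : ‖q‖ < 1) : ∃ C : ℝ, 0 < C ∧ ∀ n, ‖qPoch a q n‖ ≤ C :=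
  exists_norm_le_of_tendsto (tendsto_qPoch a hq)

theorem exists_norm_inv_qPoch_le (hq : ‖q‖ < 1) (h : ∀ i : ℕ, 1 - a * q ^ i ≠ 0) :
    ∃ C : ℝ, 0 < C ∧ ∀ n, ‖(qPoch a q n)⁻¹‖ ≤ C :=
  exists_norm_le_of_tendsto ((tendsto_qPoch a hq).inv₀ (qPochInf_ne_zero hq h))

theorem exists_norm_inv_one_sub_pow_succ_le (hq : ‖q‖ < 1) :
    ∃ C : ℝ, 0 < C ∧ ∀ n : ℕ, ‖(1 - q ^ (n + 1))⁻¹‖ ≤ C := by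
  refine exists_norm_le_of_tendsto (l := 1) ?_
  have h := (tendsto_add_atTop_iff_nat 1).2 (tendsto_pow_atTop_nhds_zero_of_norm_lt_one hq)
  simpa using (h.const_sub 1).inv₀ (by simp)

end QPoch

section Gauss

variable {p z : ℂ}

theorem tendsto_sum_of_wzPair {E : Type*} [NormedAddCommGroup E] [CompleteSpace E]
    {F G : ℕ → ℕ → E} {f : ℕ → E} {bound : ℕ → ℝ}
    (hFG : ∀ n j, F n j - F (n + 1) j = G n j - G n (j + 1))
    (hbound : Summable bound) (hF : ∀ n j, ‖F n j‖ ≤ bound j)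
    (hf : ∀ j, Tendsto (F · j) atTop (𝓝 (f j))) (hG : ∀ n, Tendsto (G n) atTop (𝓝 0)) :
    Tendsto (fun n => ∑ i ∈ range n, G i 0) atTop (𝓝 (∑' j, F 0 j - ∑' j, f j)) := by
  have hsum : ∀ n, Summable (F n) := fun n => .of_norm_bounded hbound (hF n)
  have hrow : ∀ n, ∑' j, F n j - ∑' j, F (n + 1) j = G n 0 := fun n => by
    rw [← (hsum n).tsum_sub (hsum (n + 1))]
    refine ((((hsum n).sub (hsum (n + 1))).hasSum_iff_tendsto_nat).2 ?_).tsum_eq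
    simp only [hFG, sum_range_sub']
    simpa using (hG n).const_sub (G n 0)
  simp only [← hrow, sum_range_sub' fun n => ∑' j, F n j]
  exact (tendsto_tsum_of_dominated_convergence hbound hf (.of_forall hF)).const_sub _

/-- The summand of the first member of the WZ pair proving the `q`-Gauss sum: `gaussWZ a b z p 0`
is the summand of `₂φ₁(a, b; zab; p, z)`. -/
noncomputable def gaussWZ (a b z p : ℂ) (n j : ℕ) : ℂ :=
  qPoch (z * a) p n * qPoch (z * b) p n * (qPoch z p n)⁻¹ * (qPoch (z * a * b) p (n + j))⁻¹
    * (qPoch a p j * qPoch b p j * (qPoch p p j)⁻¹) * (z * p ^ n) ^ j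

theorem gaussWZ_telescope (a b : ℂ) (hp : ‖p‖ < 1) (hz : ‖z‖ < 1)
    (hc : ∀ i : ℕ, 1 - z * a * b * p ^ i ≠ 0) (n j : ℕ) :
    gaussWZ a b z p n j - gaussWZ a b z p (n + 1) j
      = (1 - p ^ j) / (1 - z * p ^ n) * gaussWZ a b z p n j
        - (1 - p ^ (j + 1)) / (1 - z * p ^ n) * gaussWZ a b z p n (j + 1) := by
  have h1 : 1 - z * a * b * p ^ n * p ^ j ≠ 0 := by
    simpa only [pow_add, ← mul_assoc] using hc (n + j)
  have h2 := one_sub_mul_pow_ne_zero hz hp.le n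
  have h3 : 1 - p ^ j * p ≠ 0 := by simpa only [pow_succ] using one_sub_pow_succ_ne_zero hp j
  simp only [gaussWZ, add_right_comm n 1 j, ← add_assoc n j 1, qPoch_succ, mul_inv, pow_succ,
    mul_pow, pow_add]
  rw [mul_comm p (p ^ j)]
  generalize qPoch a p j = A, qPoch b p j = B, (qPoch p p j)⁻¹ = C,
    (qPoch (z * a * b) p (n + j))⁻¹ = D, p ^ j = x, p ^ n = w, z ^ j = y at *
  field_simp
  ring

theorem exists_norm_gaussWZ_le (a b : ℂ) (hp : ‖p‖ < 1) (hz : ‖z‖ < 1)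
    (hc : ∀ i : ℕ, 1 - z * a * b * p ^ i ≠ 0) :
    ∃ C : ℝ, ∀ n j, ‖gaussWZ a b z p n j‖ ≤ C * ‖z‖ ^ j := by
  obtain ⟨A, hA, hA'⟩ := exists_norm_qPoch_le (z * a) hp
  obtain ⟨B, hB, hB'⟩ := exists_norm_qPoch_le (z * b) hp
  obtain ⟨D, hD, hD'⟩ := exists_norm_inv_qPoch_le hp (one_sub_mul_pow_ne_zero hz hp.le)
  obtain ⟨E, hE, hE'⟩ := exists_norm_inv_qPoch_le hp hc
  obtain ⟨R, hR, hR'⟩ := exists_norm_qPoch_le a hp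
  obtain ⟨S, hS, hS'⟩ := exists_norm_qPoch_le b hp
  obtain ⟨T, hT, hT'⟩ := exists_norm_inv_qPoch_le hp (one_sub_mul_pow_ne_zero hp hp.le)
  refine ⟨A * B * D * E * (R * S * T), fun n j => ?_⟩
  rw [gaussWZ]
  simp only [norm_mul _ (_ ^ j), norm_pow _ j]
  simp only [norm_mul (_ * _) _, norm_mul (qPoch _ _ _) _]
  gcongr
  exacts [hA' n, hB' n, hD' n, hE' _, hR' j, hS' j, hT' j, norm_mul_pow_le z hp.le n]

theorem tendsto_gaussWZ (a b : ℂ) (hp : ‖p‖ < 1) (hz : ‖z‖ < 1)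
    (hc : ∀ i : ℕ, 1 - z * a * b * p ^ i ≠ 0) (j : ℕ) :
    Tendsto (gaussWZ a b z p · j) atTop (𝓝 (if j = 0 then
      qPochInf (z * a) p * qPochInf (z * b) p / (qPochInf z p * qPochInf (z * a * b) p)
      else 0)) := by
  have hpow : Tendsto (fun n : ℕ => (z * p ^ n) ^ j) atTop (𝓝 (0 ^ j)) := by
    simpa using ((tendsto_pow_atTop_nhds_zero_of_norm_lt_one hp).const_mul z).pow j
  have hz0 := qPochInf_ne_zero hp (one_sub_mul_pow_ne_zero hz hp.le)
  have h := (((((tendsto_qPoch (z * a) hp).mul (tendsto_qPoch (z * b) hp)).mul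
    ((tendsto_qPoch z hp).inv₀ hz0)).mul (((tendsto_qPoch (z * a * b) hp).inv₀
    (qPochInf_ne_zero hp hc)).comp (tendsto_add_atTop_nat j))).mul_const
    (qPoch a p j * qPoch b p j * (qPoch p p j)⁻¹)).mul hpow
  refine (h.congr fun n => rfl).trans_eq ?_
  rcases eq_or_ne j 0 with rfl | hj
  · simp [qPoch_zero, div_eq_mul_inv, mul_assoc, mul_comm (qPochInf z p)⁻¹]
  · simp [hj]

theorem hasSum_gauss (a b : ℂ) (hp : ‖p‖ < 1) (hz : ‖z‖ < 1)
    (hc : ∀ i : ℕ, 1 - z * a * b * p ^ i ≠ 0) :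
    HasSum (fun j => qPoch a p j * qPoch b p j / (qPoch p p j * qPoch (z * a * b) p j) * z ^ j)
      (qPochInf (z * a) p * qPochInf (z * b) p / (qPochInf z p * qPochInf (z * a * b) p)) := by
  obtain ⟨C, hC⟩ := exists_norm_gaussWZ_le a b hp hz hc
  have hbound : Summable fun j : ℕ => C * ‖z‖ ^ j :=
    (summable_geometric_of_lt_one (norm_nonneg z) hz).mul_left C
  have hsum : ∀ n, Summable (gaussWZ a b z p n) := fun n => .of_norm_bounded hbound (hC n)
  have hWZ := tendsto_sum_of_wzPair (gaussWZ_telescope a b hp hz hc) hbound hC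
    (tendsto_gaussWZ a b hp hz hc) fun n => by
      simpa using (((tendsto_pow_atTop_nhds_zero_of_norm_lt_one hp).const_sub 1).div_const
        (1 - z * p ^ n)).mul (hsum n).tendsto_atTop_zero
  simp only [pow_zero, sub_self, zero_div, zero_mul, sum_const_zero, tendsto_const_nhds_iff,
    tsum_ite_eq] at hWZ
  rw [← sub_eq_zero.1 hWZ.symm]
  convert (hsum 0).hasSum using 2 with j
  simp only [gaussWZ, qPoch_zero, zero_add, pow_zero, mul_one, div_eq_mul_inv, mul_inv, inv_one]
  ring

/-- The summand of the first member of the WZ pair that turns the derivative of the `q`-Gauss sum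
at `a = 1` into a Lambert series. -/
noncomputable def gaussLogWZ (b z p : ℂ) (n j : ℕ) : ℂ :=
  qPoch b p (j + 1) * qPoch (z * b) p n / qPoch (z * b) p (n + (j + 1)) * (z * p ^ n) ^ (j + 1)
    / (1 - p ^ (j + 1))

theorem gaussLogWZ_telescope (b : ℂ) (hp : ‖p‖ < 1) (hz : ‖z‖ < 1)
    (hc : ∀ i : ℕ, 1 - z * b * p ^ i ≠ 0) (n j : ℕ) :
    gaussLogWZ b z p n j - gaussLogWZ b z p (n + 1) j
      = (1 - p ^ (j + 1)) / (1 - z * p ^ n) * gaussLogWZ b z p n j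
        - (1 - p ^ (j + 1 + 1)) / (1 - z * p ^ n) * gaussLogWZ b z p n (j + 1) := by
  have h1 : 1 - p ^ (j + 1) * z * b * p ^ n ≠ 0 := by
    convert hc (n + (j + 1)) using 2
    ring
  have h2 := one_sub_mul_pow_ne_zero hz hp.le n
  have h3 := one_sub_pow_succ_ne_zero hp j
  have h4 : 1 - p ^ (j + 1) * p ≠ 0 := by
    simpa only [pow_succ] using one_sub_pow_succ_ne_zero hp (j + 1)
  have h5 := qPoch_ne_zero hc (n + (j + 1))
  simp only [gaussLogWZ, add_right_comm n 1 (j + 1), ← add_assoc n (j + 1) 1,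
    qPoch_succ _ _ (n + (j + 1)), qPoch_succ _ _ (j + 1), qPoch_succ _ _ n,
    pow_succ _ (j + 1), mul_pow, pow_add _ n (j + 1), pow_succ p n]
  generalize qPoch b p (j + 1) = A, qPoch (z * b) p (n + (j + 1)) = D, qPoch (z * b) p n = B,
    p ^ (j + 1) = x, p ^ n = w, z ^ (j + 1) = y at *
  field_simp
  ring

theorem exists_norm_gaussLogWZ_le (b : ℂ) (hp : ‖p‖ < 1)
    (hc : ∀ i : ℕ, 1 - z * b * p ^ i ≠ 0) :
    ∃ C : ℝ, ∀ n j, ‖gaussLogWZ b z p n j‖ ≤ C * ‖z‖ ^ (j + 1) := by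
  obtain ⟨A, hA, hA'⟩ := exists_norm_qPoch_le b hp
  obtain ⟨B, hB, hB'⟩ := exists_norm_qPoch_le (z * b) hp
  obtain ⟨D, hD, hD'⟩ := exists_norm_inv_qPoch_le hp hc
  obtain ⟨E, hE, hE'⟩ := exists_norm_inv_one_sub_pow_succ_le hp
  refine ⟨A * B * D * E, fun n j => ?_⟩
  have h : gaussLogWZ b z p n j = qPoch b p (j + 1) * qPoch (z * b) p n
      * (qPoch (z * b) p (n + (j + 1)))⁻¹ * (1 - p ^ (j + 1))⁻¹ * (z * p ^ n) ^ (j + 1) := by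
    rw [gaussLogWZ]
    ring
  rw [h, norm_mul _ (_ ^ (j + 1)), norm_pow]
  simp only [norm_mul _ (_)⁻¹, norm_mul (qPoch _ _ _)]
  gcongr
  exacts [hA' _, hB' n, hD' _, hE' j, norm_mul_pow_le z hp.le n]

theorem tendsto_gaussLogWZ (b : ℂ) (hp : ‖p‖ < 1) (hc : ∀ i : ℕ, 1 - z * b * p ^ i ≠ 0) (j : ℕ) :
    Tendsto (gaussLogWZ b z p · j) atTop (𝓝 0) := by
  have hpow := ((tendsto_pow_atTop_nhds_zero_of_norm_lt_one hp).const_mul z).pow (j + 1)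
  have h := ((((tendsto_qPoch (z * b) hp).const_mul (qPoch b p (j + 1))).div
    ((tendsto_qPoch (z * b) hp).comp (tendsto_add_atTop_nat (j + 1)))
    (qPochInf_ne_zero hp hc)).mul hpow).div_const (1 - p ^ (j + 1))
  simpa [gaussLogWZ] using h

theorem gaussLogWZ_zero_right (b : ℂ) (hp : ‖p‖ < 1) (hz : ‖z‖ < 1)
    (hc : ∀ i : ℕ, 1 - z * b * p ^ i ≠ 0) (n : ℕ) :
    (1 - p ^ (0 + 1)) / (1 - z * p ^ n) * gaussLogWZ b z p n 0
      = z * p ^ n / (1 - z * p ^ n) - z * b * p ^ n / (1 - z * b * p ^ n) := by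
  have h1 : 1 - z * p ^ n * b ≠ 0 := by simpa only [mul_right_comm] using hc n
  have h2 := one_sub_mul_pow_ne_zero hz hp.le n
  have h3 := one_sub_pow_succ_ne_zero hp 0
  have h4 := qPoch_ne_zero hc n
  simp only [gaussLogWZ, zero_add, qPoch_succ, qPoch_zero, pow_zero, mul_one, one_mul,
    pow_one] at h3 ⊢
  field_simp
  ring

/-- The general term of the Lambert-type series `∑_{n ≥ 1} (b)_n z ^ n / ((zb)_n (1 - p ^ n))`,
indexed from `0`. -/
noncomputable def gaussLogTerm (b z p : ℂ) (j : ℕ) : ℂ :=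
  qPoch b p (j + 1) / qPoch (z * b) p (j + 1) * z ^ (j + 1) / (1 - p ^ (j + 1))

theorem summable_gaussLogTerm (b : ℂ) (hp : ‖p‖ < 1) (hz : ‖z‖ < 1)
    (hc : ∀ i : ℕ, 1 - z * b * p ^ i ≠ 0) : Summable (gaussLogTerm b z p) := by
  obtain ⟨C, hC⟩ := exists_norm_gaussLogWZ_le b hp hc
  refine .of_norm_bounded (((summable_nat_add_iff 1).2
    (summable_geometric_of_lt_one (norm_nonneg z) hz)).mul_left C) fun j => ?_
  simpa [gaussLogTerm, gaussLogWZ, qPoch_zero] using hC 0 j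

/-- The `q`-Gauss sum differentiated at `a = 1`: the left-hand side is the logarithmic derivative
of the infinite products. -/
theorem tendsto_sum_lambert (b : ℂ) (hp : ‖p‖ < 1) (hz : ‖z‖ < 1)
    (hc : ∀ i : ℕ, 1 - z * b * p ^ i ≠ 0) :
    Tendsto (fun n => ∑ i ∈ range n,
      (z * p ^ i / (1 - z * p ^ i) - z * b * p ^ i / (1 - z * b * p ^ i)))
      atTop (𝓝 (∑' j, gaussLogTerm b z p j)) := by
  obtain ⟨C, hC⟩ := exists_norm_gaussLogWZ_le b hp hc
  have hbound : Summable fun j : ℕ => C * ‖z‖ ^ (j + 1) :=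
    ((summable_nat_add_iff 1).2 (summable_geometric_of_lt_one (norm_nonneg z) hz)).mul_left C
  have hWZ := tendsto_sum_of_wzPair (gaussLogWZ_telescope b hp hz hc) hbound hC
    (tendsto_gaussLogWZ b hp hc) fun n => by
    have h := (Summable.of_norm_bounded hbound (hC n)).tendsto_atTop_zero
    have hpow := (tendsto_add_atTop_iff_nat 1).2 (tendsto_pow_atTop_nhds_zero_of_norm_lt_one hp)
    simpa using ((hpow.const_sub 1).div_const (1 - z * p ^ n)).mul h
  simp only [gaussLogWZ_zero_right b hp hz hc, tsum_zero, sub_zero] at hWZ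
  simpa only [gaussLogWZ, gaussLogTerm, qPoch_zero, pow_zero, mul_one, zero_add] using hWZ

end Gauss

section Jackson

variable {a p e s t : ℂ}

/-- The cubic `(1 - b x)(1 - c x)(1 - d x)` with `b c d = a² p`, up to a factor `e`. Up to that
factor, `s = b + c + d` and `t = a p (1/b + 1/c + 1/d)`; the value `e = 0` covers the limit
`b, c → ∞`. -/
noncomputable def jacksonNum (a p e s t x : ℂ) : ℂ :=
  e - s * x + a * t * x ^ 2 - a ^ 2 * p * e * x ^ 3

/-- The cubic `(1 - a p x / b)(1 - a p x / c)(1 - a p x / d)` that accompanies `jacksonNum`. -/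
noncomputable def jacksonDen (a p e s t x : ℂ) : ℂ :=
  e - t * x + p * s * x ^ 2 - a * p ^ 2 * e * x ^ 3

/-- The part `(a, b, c, d; p)_m / ((1 - a) (p, ap/b, ap/c, ap/d; p)_m)` of the summand of
Jackson's series. -/
noncomputable def jacksonCoeff (a p e s t : ℂ) (m : ℕ) : ℂ :=
  qPoch a p m / ((1 - a) * qPoch p p m)
    * ∏ i ∈ range m, jacksonNum a p e s t (p ^ i) / jacksonDen a p e s t (p ^ i)

/-- The part of the `m`-th summand of Jackson's terminating very-well-poised series
`₈φ₇(a; b, c, d, p ^ n, p ^ (-n))` that does not depend on `n`. -/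
noncomputable def jacksonFactor (a p e s t : ℂ) (m : ℕ) : ℂ :=
  (1 - a * p ^ (2 * m)) * jacksonCoeff a p e s t m

/-- The sum `(b/a, c/a, d/a; p)_n / (ap/b, ap/c, ap/d; p)_n` of Jackson's series. -/
noncomputable def jacksonSum (a p e s t : ℂ) (n : ℕ) : ℂ :=
  ∏ i ∈ range n, jacksonNum a p e s t (p ^ i / a) / jacksonDen a p e s t (p ^ i)

/-- The part of the `m`-th summand of Jackson's series that depends on `n = m + j`, divided by
`(ap; p)_n / (1/a; p)_n`. -/
noncomputable def jacksonKernel (a p : ℂ) (m j : ℕ) : ℂ :=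
  qPoch p p (m + j) * qPoch (p ^ (m + j)) p m * qPoch (1 / a) p j
    / (a ^ m * qPoch p p j * qPoch (a * p) p (2 * m + j))

/-- The certificate that turns the recursion in `n` for the sum over `m + j = n` into a telescoping
sum. -/
noncomputable def jacksonCertificate (a p e s t : ℂ) : ℕ → ℕ → ℂ
  | 0, _ => 0
  | m + 1, j => -(p ^ j * (1 - p ^ (2 * (m + j) + 1)) * (1 - a * p ^ m)
      * jacksonNum a p e s t (p ^ m) * jacksonCoeff a p e s t m * qPoch p p (2 * m + j)
      * qPoch (1 / a) p j) / (a ^ (m + 1) * qPoch p p j * qPoch (a * p) p (2 * m + j + 1))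

theorem jacksonCoeff_succ (hp : ‖p‖ < 1) (hden : ∀ i : ℕ, jacksonDen a p e s t (p ^ i) ≠ 0)
    (m : ℕ) :
    (1 - p ^ (m + 1)) * jacksonDen a p e s t (p ^ m) * jacksonCoeff a p e s t (m + 1)
      = (1 - a * p ^ m) * jacksonNum a p e s t (p ^ m) * jacksonCoeff a p e s t m := by
  have h1 := one_sub_pow_succ_ne_zero hp m
  have h2 := hden m
  rw [jacksonCoeff, jacksonCoeff, prod_range_succ, qPoch_succ, qPoch_succ, ← pow_succ']
  field_simp

theorem jacksonKernel_zero_left (hp : ‖p‖ < 1) (j : ℕ) :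
    jacksonKernel a p 0 j = qPoch (1 / a) p j / qPoch (a * p) p j := by
  have := qPoch_self_ne_zero hp j
  simp only [jacksonKernel, zero_add, qPoch_zero, mul_zero, pow_zero, mul_one, one_mul]
  field_simp

theorem jacksonKernel_succ_left (m j : ℕ) :
    jacksonKernel a p (m + 1) j
      = (1 - p ^ (m + j + 1)) * qPoch p p (2 * m + j + 1) * qPoch (1 / a) p j
        / (a ^ (m + 1) * qPoch p p j * qPoch (a * p) p (2 * m + j + 2)) := by
  have h : qPoch p p (m + 1 + j) * qPoch (p ^ (m + 1 + j)) p (m + 1)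
      = (1 - p ^ (m + j + 1)) * qPoch p p (2 * m + j + 1) := by
    rw [qPoch_succ', ← pow_succ, add_right_comm m 1 j, show 2 * m + j + 1 = m + j + 1 + m by ring,
      qPoch_add p p (m + j + 1) m, ← pow_succ']
    ring
  rw [jacksonKernel, h, show 2 * (m + 1) + j = 2 * m + j + 2 by ring]

theorem jackson_telescope_zero (ha : a ≠ 0) (ha1 : 1 - a ≠ 0) (hp : ‖p‖ < 1)
    (hap : ∀ i : ℕ, 1 - a * p * p ^ i ≠ 0) (j : ℕ) :
    jacksonDen a p e s t (p ^ j) * (jacksonFactor a p e s t 0 * jacksonKernel a p 0 (j + 1))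
      - jacksonNum a p e s t (p ^ j / a) * (jacksonFactor a p e s t 0 * jacksonKernel a p 0 j)
      = jacksonCertificate a p e s t 1 j := by
  have hP := qPoch_self_ne_zero hp j
  have hA := qPoch_ne_zero hap j
  have h1 : 1 - p ^ j * p * a ≠ 0 := by convert hap j using 2; ring
  have hC : jacksonCoeff a p e s t 0 = (1 - a)⁻¹ := by simp [jacksonCoeff, qPoch_zero]
  simp only [jacksonFactor, jacksonKernel_zero_left hp, jacksonCertificate, hC, mul_zero, pow_zero,
    zero_add, mul_one, qPoch_succ, jacksonNum, jacksonDen, one_pow]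
  rw [show p ^ (2 * j + 1) = (p ^ j) ^ 2 * p by ring]
  generalize qPoch (1 / a) p j = X, qPoch p p j = Y, qPoch (a * p) p j = Z, p ^ j = y at *
  field_simp
  ring

theorem jacksonCertificate_zero_left (j : ℕ) : jacksonCertificate a p e s t 0 j = 0 := rfl

theorem jacksonCertificate_succ (hp : ‖p‖ < 1) (hden : ∀ i : ℕ, jacksonDen a p e s t (p ^ i) ≠ 0)
    (m j : ℕ) :
    jacksonCertificate a p e s t (m + 1) j
      = -(p ^ j * (1 - p ^ (2 * (m + j) + 1)) * (1 - p ^ (m + 1)) * jacksonDen a p e s t (p ^ m)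
        * jacksonCoeff a p e s t (m + 1) * qPoch p p (2 * m + j) * qPoch (1 / a) p j)
        / (a ^ (m + 1) * qPoch p p j * qPoch (a * p) p (2 * m + j + 1)) := by
  rw [jacksonCertificate]
  congr 1
  linear_combination p ^ j * (1 - p ^ (2 * (m + j) + 1)) * qPoch p p (2 * m + j)
    * qPoch (1 / a) p j * jacksonCoeff_succ hp hden m

theorem jackson_telescope_succ (ha : a ≠ 0) (hp : ‖p‖ < 1)
    (hap : ∀ i : ℕ, 1 - a * p * p ^ i ≠ 0) (hden : ∀ i : ℕ, jacksonDen a p e s t (p ^ i) ≠ 0)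
    (m j : ℕ) :
    jacksonDen a p e s t (p ^ (m + 1 + j))
        * (jacksonFactor a p e s t (m + 1) * jacksonKernel a p (m + 1) (j + 1))
      - jacksonNum a p e s t (p ^ (m + 1 + j) / a)
        * (jacksonFactor a p e s t (m + 1) * jacksonKernel a p (m + 1) j)
      = jacksonCertificate a p e s t (m + 2) j - jacksonCertificate a p e s t (m + 1) (j + 1) := by
  have hP := qPoch_self_ne_zero hp j
  have hA := qPoch_ne_zero hap (2 * m + j + 2)
  have h1 : 1 - (p ^ m) ^ 2 * p ^ 3 * p ^ j * a ≠ 0 := by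
    convert hap (2 * m + j + 2) using 2; ring
  have h2 : 1 - p * p ^ j ≠ 0 := one_sub_mul_pow_ne_zero hp hp.le j
  rw [jacksonCertificate_succ hp hden m (j + 1), jacksonCertificate, jacksonFactor,
    jacksonKernel_succ_left, jacksonKernel_succ_left]
  simp only [show 2 * (m + 1) + j = 2 * m + j + 1 + 1 by ring,
    show 2 * m + (j + 1) = 2 * m + j + 1 by ring,
    show 2 * m + j + 1 + 1 = 2 * m + j + 2 by ring,
    show 2 * m + j + 1 + 2 = 2 * m + j + 2 + 1 by ring,
    show m + (j + 1) + 1 = m + j + 2 by ring,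
    qPoch_succ _ _ j, qPoch_succ (a * p) p (2 * m + j + 2), jacksonNum, jacksonDen]
  rw [show qPoch p p (2 * m + j + 2) = qPoch p p (2 * m + j + 1) * (1 - p * p ^ (2 * m + j + 1))
    from qPoch_succ p p (2 * m + j + 1)]
  simp only [pow_add, pow_mul', pow_one]
  generalize qPoch (1 / a) p j = X, qPoch p p j = Y, qPoch (a * p) p (2 * m + j + 2) = Z,
    qPoch p p (2 * m + j + 1) = W, p ^ j = y, p ^ m = x, jacksonCoeff a p e s t (m + 1) = c at *
  field_simp
  ring

theorem jackson_boundary (ha : a ≠ 0) (hp : ‖p‖ < 1) (hap : ∀ i : ℕ, 1 - a * p * p ^ i ≠ 0)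
    (hden : ∀ i : ℕ, jacksonDen a p e s t (p ^ i) ≠ 0) (n : ℕ) :
    jacksonDen a p e s t (p ^ n)
        * (jacksonFactor a p e s t (n + 1) * jacksonKernel a p (n + 1) 0)
      = -jacksonCertificate a p e s t (n + 1) 0 := by
  have hA := qPoch_ne_zero hap (2 * n + 1)
  have h1 : 1 - a * (p ^ n) ^ 2 * p ^ 2 ≠ 0 := by convert hap (2 * n + 1) using 2; ring
  rw [jacksonCertificate_succ hp hden, jacksonKernel_succ_left, jacksonFactor]
  simp only [add_zero, qPoch_zero, qPoch_succ p p (2 * n), qPoch_succ (a * p) p (2 * n + 1),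
    pow_add, pow_mul', mul_add, pow_one, pow_zero]
  generalize p ^ n = x at *
  field_simp

theorem jackson_telescope (ha : a ≠ 0) (ha1 : 1 - a ≠ 0) (hp : ‖p‖ < 1)
    (hap : ∀ i : ℕ, 1 - a * p * p ^ i ≠ 0) (hden : ∀ i : ℕ, jacksonDen a p e s t (p ^ i) ≠ 0)
    (m j : ℕ) :
    jacksonDen a p e s t (p ^ (m + j))
        * (jacksonFactor a p e s t m * jacksonKernel a p m (j + 1))
      - jacksonNum a p e s t (p ^ (m + j) / a)
        * (jacksonFactor a p e s t m * jacksonKernel a p m j)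
      = jacksonCertificate a p e s t (m + 1) j - jacksonCertificate a p e s t m (j + 1) := by
  cases m with
  | zero => simpa [jacksonCertificate_zero_left] using jackson_telescope_zero ha ha1 hp hap j
  | succ m => exact jackson_telescope_succ ha hp hap hden m j

theorem sum_jacksonFactor_mul_jacksonKernel (ha : a ≠ 0) (ha1 : 1 - a ≠ 0) (hp : ‖p‖ < 1)
    (hap : ∀ i : ℕ, 1 - a * p * p ^ i ≠ 0) (hden : ∀ i : ℕ, jacksonDen a p e s t (p ^ i) ≠ 0)
    (n : ℕ) :
    ∑ x ∈ antidiagonal n, jacksonFactor a p e s t x.1 * jacksonKernel a p x.1 x.2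
      = jacksonSum a p e s t n := by
  induction n with
  | zero => simp [jacksonFactor, jacksonKernel, jacksonCoeff, jacksonSum, qPoch_zero, ha1]
  | succ n ih =>
    set f := fun x : ℕ × ℕ => jacksonFactor a p e s t x.1 * jacksonKernel a p x.1 x.2
    have telescope : jacksonDen a p e s t (p ^ n) * ∑ x ∈ antidiagonal n, f (x.1, x.2 + 1)
          - jacksonNum a p e s t (p ^ n / a) * ∑ x ∈ antidiagonal n, f x
        = ∑ x ∈ antidiagonal n, (jacksonCertificate a p e s t (x.1 + 1) x.2
          - jacksonCertificate a p e s t x.1 (x.2 + 1)) := by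
      rw [mul_sum, mul_sum, ← sum_sub_distrib]
      refine sum_congr rfl fun x hx => ?_
      rw [← jackson_telescope ha ha1 hp hap hden, mem_antidiagonal.1 hx]
    have certificate := (Finset.Nat.sum_antidiagonal_succ (n := n)
      (f := fun x => jacksonCertificate a p e s t x.1 x.2)).symm.trans
        Finset.Nat.sum_antidiagonal_succ'
    have step : jacksonDen a p e s t (p ^ n) * ∑ x ∈ antidiagonal (n + 1), f x
        = jacksonNum a p e s t (p ^ n / a) * jacksonSum a p e s t n := by
      rw [sum_sub_distrib, ih] at telescope
      rw [jacksonCertificate_zero_left, zero_add] at certificate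
      rw [Finset.Nat.sum_antidiagonal_succ']
      linear_combination telescope + jackson_boundary ha hp hap hden n + certificate
    rw [jacksonSum, prod_range_succ, ← jacksonSum, mul_div_assoc', eq_div_iff (hden n)]
    linear_combination step

end Jackson

section Transformation

variable {a p e s t : ℂ}

theorem hasSum_sum_antidiagonal {f : ℕ × ℕ → ℂ} (hf : Summable f) :
    HasSum (fun n => ∑ x ∈ antidiagonal n, f x) (∑' x, f x) := by
  have h := (HasAntidiagonal.sigmaAntidiagonalEquivProd (A := ℕ)).hasSum_iff.2 hf.hasSum
  refine h.sigma fun n => ?_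
  rw [← sum_coe_sort]
  exact hasSum_fintype _

theorem tsum_pnat_eq_of_sum_antidiagonal {f : ℕ × ℕ → ℂ} {u w : ℕ → ℂ} (hf : Summable f)
    (hu : ∀ n, ∑ x ∈ antidiagonal (n + 1), f x = u (n + 1))
    (hw : ∀ m, ∑' j, f (m + 1, j) = w (m + 1)) :
    (Summable fun n : ℕ+ => u n) ∧ (Summable fun m : ℕ+ => w m) ∧
      ∑' n : ℕ+, u n = ∑' j, f (0, j + 1) + ∑' m : ℕ+, w m := by
  have hdiag := hasSum_sum_antidiagonal hf
  have h := hdiag.tsum_eq.trans hf.tsum_prod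
  rw [hdiag.summable.tsum_eq_zero_add, hf.prod.tsum_eq_zero_add,
    (hf.prod_factor 0).tsum_eq_zero_add, Finset.Nat.antidiagonal_zero, sum_singleton,
    add_assoc] at h
  refine ⟨summable_pnat_iff_summable_succ.2 ?_, summable_pnat_iff_summable_succ.2 ?_, ?_⟩
  · simpa only [hu] using (summable_nat_add_iff 1).2 hdiag.summable
  · simpa only [hw] using (summable_nat_add_iff 1).2 hf.prod
  · rw [tsum_pnat_eq_tsum_succ, tsum_pnat_eq_tsum_succ]
    simpa only [hu, hw] using add_left_cancel h

/-- The kernel of Jackson's series with the weight `(a² p) ^ n / (1 - p ^ n)`, `n = m + j`, under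
which the sums over `j` can be evaluated. Truncated subtraction gives it the value `1` at
`m = j = 0`. -/
noncomputable def weightedKernel (a p : ℂ) (m j : ℕ) : ℂ :=
  (a * p) ^ m * (a ^ 2 * p) ^ j * qPoch p p (2 * m + j - 1) * qPoch (1 / a) p j
    / (qPoch p p j * qPoch (a * p) p (2 * m + j))

theorem qPoch_self_mul_qPoch_pow (p : ℂ) {m j : ℕ} (h : m + j ≠ 0) :
    qPoch p p (m + j) * qPoch (p ^ (m + j)) p m
      = (1 - p ^ (m + j)) * qPoch p p (2 * m + j - 1) := by
  obtain ⟨n, hn⟩ := Nat.exists_eq_succ_of_ne_zero h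
  rw [show 2 * m + j - 1 = n + m by omega, hn, Nat.succ_eq_add_one, qPoch_succ, qPoch_add p p n m,
    pow_succ']
  ring

theorem weightedKernel_eq (ha : a ≠ 0) (hp : ‖p‖ < 1) {m j : ℕ} (h : m + j ≠ 0) :
    weightedKernel a p m j = (a ^ 2 * p) ^ (m + j) / (1 - p ^ (m + j)) * jacksonKernel a p m j := by
  have hn : 1 - p ^ (m + j) ≠ 0 := by
    obtain ⟨n, hn⟩ := Nat.exists_eq_succ_of_ne_zero h
    simpa only [hn] using one_sub_pow_succ_ne_zero hp n
  rw [jacksonKernel, qPoch_self_mul_qPoch_pow p h, weightedKernel,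
    show a * p = a ^ 2 * p / a by field_simp, pow_add, div_pow]
  field_simp

theorem weightedKernel_zero_left_succ (hp : ‖p‖ < 1) (j : ℕ) :
    weightedKernel a p 0 (j + 1) = gaussLogTerm (1 / a) (a ^ 2 * p) p j := by
  have h1 := one_sub_pow_succ_ne_zero hp j
  have h2 := qPoch_self_ne_zero hp j
  have h3 : a ^ 2 * p * (1 / a) = a * p := by
    rcases eq_or_ne a 0 with rfl | ha
    · simp
    · field_simp
  rw [weightedKernel, gaussLogTerm, h3, qPoch_succ p p j, ← pow_succ']
  simp only [mul_zero, zero_add, Nat.add_sub_cancel, pow_zero, one_mul]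
  field_simp

theorem exists_norm_weightedKernel_le (hp : ‖p‖ < 1) (hap : ‖a * p‖ < 1) :
    ∃ C : ℝ, ∀ m j, ‖weightedKernel a p m j‖ ≤ C * (‖a * p‖ ^ m * ‖a ^ 2 * p‖ ^ j) := by
  obtain ⟨A, hA, hA'⟩ := exists_norm_qPoch_le p hp
  obtain ⟨B, hB, hB'⟩ := exists_norm_qPoch_le (1 / a) hp
  obtain ⟨D, hD, hD'⟩ := exists_norm_inv_qPoch_le hp (one_sub_mul_pow_ne_zero hp hp.le)
  obtain ⟨E, -, hE⟩ := exists_norm_inv_qPoch_le hp (one_sub_mul_pow_ne_zero hap hp.le)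
  refine ⟨A * B * (D * E), fun m j => ?_⟩
  calc ‖weightedKernel a p m j‖
      = ‖qPoch p p (2 * m + j - 1)‖ * ‖qPoch (1 / a) p j‖ * (‖(qPoch p p j)⁻¹‖
          * ‖(qPoch (a * p) p (2 * m + j))⁻¹‖) * (‖a * p‖ ^ m * ‖a ^ 2 * p‖ ^ j) := by
        simp only [weightedKernel, div_eq_mul_inv, mul_inv, ← norm_mul, ← norm_pow]
        congr 1
        ring
    _ ≤ A * B * (D * E) * (‖a * p‖ ^ m * ‖a ^ 2 * p‖ ^ j) := by
        gcongr
        exacts [hA' _, hB' _, hD' _, hE _]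

theorem weightedKernel_succ_left_eq (m j : ℕ) :
    weightedKernel a p (m + 1) j
      = (a * p) ^ (m + 1) * qPoch p p (2 * m + 1) / qPoch (a * p) p (2 * m + 2)
        * (qPoch (p ^ (2 * m + 2)) p j * qPoch (1 / a) p j
          / (qPoch p p j * qPoch (a * p * p ^ (2 * m + 2)) p j) * (a ^ 2 * p) ^ j) := by
  rw [weightedKernel, show 2 * (m + 1) + j - 1 = 2 * m + 1 + j by omega,
    show 2 * (m + 1) + j = 2 * m + 2 + j by ring, qPoch_add p, qPoch_add (a * p), ← pow_succ' p]
  simp only [div_eq_mul_inv, mul_inv]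
  ring

theorem hasSum_weightedKernel (ha : a ≠ 0) (hp : ‖p‖ < 1) (hap : ‖a * p‖ < 1)
    (hz : ‖a ^ 2 * p‖ < 1) (m : ℕ) :
    HasSum (weightedKernel a p (m + 1))
      ((a * p) ^ (m + 1) * qPoch p p (2 * m + 1) / qPoch (a ^ 2 * p) p (2 * m + 2)) := by
  have hc := one_sub_mul_pow_ne_zero hap hp.le
  have hshift : ∀ i : ℕ, 1 - a * p * p ^ (2 * m + 2) * p ^ i ≠ 0 := fun i => by
    rw [mul_assoc, ← pow_add]; exact hc _
  have hb : a ^ 2 * p * (1 / a) = a * p := by field_simp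
  have hab : a ^ 2 * p * p ^ (2 * m + 2) * (1 / a) = a * p * p ^ (2 * m + 2) := by field_simp
  have gauss := hasSum_gauss (p ^ (2 * m + 2)) (1 / a) hp hz (by rwa [hab])
  have h1 := qPoch_ne_zero hc (2 * m + 2)
  have h2 := qPoch_ne_zero (one_sub_mul_pow_ne_zero hz hp.le) (2 * m + 2)
  have h3 := qPochInf_ne_zero hp hshift
  have h4 : qPochInf (a ^ 2 * p * p ^ (2 * m + 2)) p ≠ 0 :=
    qPochInf_ne_zero hp (one_sub_mul_pow_ne_zero ((norm_mul_pow_le _ hp.le _).trans_lt hz) hp.le)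
  rw [hab, hb, qPochInf_eq_mul (a * p) hp (2 * m + 2),
    qPochInf_eq_mul (a ^ 2 * p) hp (2 * m + 2)] at gauss
  rw [funext (weightedKernel_succ_left_eq m)]
  refine (gauss.summable.mul_left _).hasSum_iff.2 ?_
  rw [tsum_mul_left, gauss.tsum_eq]
  field_simp

theorem sum_antidiagonal_weightedKernel (ha : a ≠ 0) (ha1 : 1 - a ≠ 0) (hp : ‖p‖ < 1)
    (hap : ‖a * p‖ < 1) (hden : ∀ i : ℕ, jacksonDen a p e s t (p ^ i) ≠ 0) (n : ℕ) :
    ∑ x ∈ antidiagonal (n + 1), jacksonFactor a p e s t x.1 * weightedKernel a p x.1 x.2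
      = jacksonSum a p e s t (n + 1) * (a ^ 2 * p) ^ (n + 1) / (1 - p ^ (n + 1)) := by
  rw [← sum_jacksonFactor_mul_jacksonKernel ha ha1 hp (one_sub_mul_pow_ne_zero hap hp.le) hden,
    mul_div_assoc, sum_mul]
  refine sum_congr rfl fun x hx => ?_
  have hx := mem_antidiagonal.1 hx
  rw [weightedKernel_eq ha hp (by omega), hx]
  ring

theorem summable_jacksonFactor_mul_weightedKernel (hp : ‖p‖ < 1) (hap : ‖a * p‖ < 1)
    (hz : ‖a ^ 2 * p‖ < 1) (hV : ∃ C : ℝ, ∀ m, ‖jacksonFactor a p e s t m‖ ≤ C) :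
    Summable fun x : ℕ × ℕ => jacksonFactor a p e s t x.1 * weightedKernel a p x.1 x.2 := by
  obtain ⟨A, hA⟩ := hV
  obtain ⟨B, hB⟩ := exists_norm_weightedKernel_le hp hap
  have geometric := (summable_geometric_of_lt_one (norm_nonneg _) hap).mul_of_nonneg
    (summable_geometric_of_lt_one (norm_nonneg _) hz) (fun _ => by positivity)
    (fun _ => by positivity)
  refine .of_norm_bounded (geometric.mul_left (A * B)) fun x => ?_
  rw [norm_mul, mul_assoc]
  exact mul_le_mul (hA _) (hB _ _) (norm_nonneg _) ((norm_nonneg _).trans (hA 0))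

theorem jackson_transformation (ha : a ≠ 0) (ha1 : 1 - a ≠ 0) (hp : ‖p‖ < 1) (hap : ‖a * p‖ < 1)
    (hz : ‖a ^ 2 * p‖ < 1) (hden : ∀ i : ℕ, jacksonDen a p e s t (p ^ i) ≠ 0)
    (hV : ∃ C : ℝ, ∀ m, ‖jacksonFactor a p e s t m‖ ≤ C) :
    (Summable fun n : ℕ+ => jacksonSum a p e s t n * (a ^ 2 * p) ^ (n : ℕ) / (1 - p ^ (n : ℕ))) ∧
    (Summable fun m : ℕ+ => jacksonFactor a p e s t m * ((a * p) ^ (m : ℕ)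
      * qPoch p p (2 * m - 1) / qPoch (a ^ 2 * p) p (2 * m))) ∧
    ∑' n : ℕ+, jacksonSum a p e s t n * (a ^ 2 * p) ^ (n : ℕ) / (1 - p ^ (n : ℕ))
      = ∑' j, gaussLogTerm (1 / a) (a ^ 2 * p) p j
        + ∑' m : ℕ+, jacksonFactor a p e s t m * ((a * p) ^ (m : ℕ)
          * qPoch p p (2 * m - 1) / qPoch (a ^ 2 * p) p (2 * m)) := by
  have hV0 : jacksonFactor a p e s t 0 = 1 := by
    simp [jacksonFactor, jacksonCoeff, qPoch_zero, ha1]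
  simp only [← weightedKernel_zero_left_succ hp]
  have exchange := tsum_pnat_eq_of_sum_antidiagonal
    (u := fun n => jacksonSum a p e s t n * (a ^ 2 * p) ^ n / (1 - p ^ n))
    (w := fun m => jacksonFactor a p e s t m * ((a * p) ^ m
      * qPoch p p (2 * m - 1) / qPoch (a ^ 2 * p) p (2 * m)))
    (summable_jacksonFactor_mul_weightedKernel hp hap hz hV)
    (sum_antidiagonal_weightedKernel ha ha1 hp hap hden) fun m => by
      dsimp only
      rw [tsum_mul_left, (hasSum_weightedKernel ha hp hap hz m).tsum_eq,
        show 2 * (m + 1) - 1 = 2 * m + 1 by omega, mul_add_one]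
  simpa only [hV0, one_mul] using exchange

end Transformation

section TripleProduct

/-- The integer `n (n - 1) / 2`, which agrees with `n.choose 2` for natural `n`. -/
def chooseTwo (n : ℤ) : ℤ := n * (n - 1) / 2

theorem two_mul_chooseTwo (n : ℤ) : 2 * chooseTwo n = n * (n - 1) :=
  Int.mul_ediv_cancel' (Int.even_mul_pred_self n).two_dvd

theorem natCast_choose_two (k : ℕ) : ((k.choose 2 : ℕ) : ℤ) = chooseTwo k := by
  rw [Nat.choose_two_right, chooseTwo]
  cases k <;> simp

/-- The `n`-th term of Jacobi's theta series `∑ₙ (-1) ^ n * q ^ (n (n - 1) / 2) * z ^ n`. -/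
noncomputable def thetaTerm (q z : ℂ) (n : ℤ) : ℂ := (-1) ^ n * q ^ chooseTwo n * z ^ n

/-- Jacobi's theta series in multiplicative notation, normalised so as to vanish at `z = 1`. -/
noncomputable def thetaSum (q z : ℂ) : ℂ := ∑' n : ℤ, thetaTerm q z n

variable {q z : ℂ}

theorem thetaTerm_div_neg (hq0 : q ≠ 0) (hz0 : z ≠ 0) (n : ℤ) :
    thetaTerm q (q / z) (-n) = thetaTerm q z n := by
  have h : chooseTwo (-n) + (-n) = chooseTwo n := by
    linarith [two_mul_chooseTwo n, two_mul_chooseTwo (-n)]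
  have h_sign : ((-1 : ℂ) ^ n)⁻¹ = (-1) ^ n := by rw [← inv_zpow]; norm_num
  rw [thetaTerm, thetaTerm, div_zpow, ← h, zpow_add₀ hq0, zpow_neg (-1 : ℂ), zpow_neg z, h_sign]
  field_simp

theorem thetaSum_div (hq0 : q ≠ 0) (hz0 : z ≠ 0) : thetaSum q (q / z) = thetaSum q z := by
  rw [thetaSum, thetaSum, ← (Equiv.neg ℤ).tsum_eq]
  exact tsum_congr fun n => thetaTerm_div_neg hq0 hz0 n

theorem summable_norm_pow_choose_two_mul_pow (hq0 : q ≠ 0) (hq : ‖q‖ < 1) (hz0 : z ≠ 0) :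
    Summable fun n : ℕ => ‖q ^ n.choose 2 * z ^ n‖ := by
  refine summable_of_ratio_test_tendsto_lt_one zero_lt_one
    (.of_forall fun n => norm_ne_zero_iff.2
      (mul_ne_zero (pow_ne_zero _ hq0) (pow_ne_zero _ hz0))) (l := 0) ?_
  have h_ratio (n : ℕ) : ‖‖q ^ (n + 1).choose 2 * z ^ (n + 1)‖‖ / ‖‖q ^ n.choose 2 * z ^ n‖‖
      = ‖q‖ ^ n * ‖z‖ := by
    have h_norm : ‖z‖ ≠ 0 := norm_ne_zero_iff.2 hz0
    simp only [norm_norm, norm_mul, norm_pow]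
    rw [Nat.choose_succ_succ' n 1, Nat.choose_one_right, pow_add, pow_succ]
    field_simp
  simp only [h_ratio]
  simpa using (tendsto_pow_atTop_nhds_zero_of_lt_one (norm_nonneg q) hq).mul_const ‖z‖

theorem summable_norm_thetaTerm (hq0 : q ≠ 0) (hq : ‖q‖ < 1) (hz0 : z ≠ 0) :
    Summable fun n : ℤ => ‖thetaTerm q z n‖ := by
  have h_nat {w : ℂ} (hw : w ≠ 0) : Summable fun n : ℕ => ‖thetaTerm q w n‖ := by
    refine (summable_norm_pow_choose_two_mul_pow hq0 hq hw).congr fun n => ?_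
    simp [thetaTerm, ← natCast_choose_two]
  refine .of_nat_of_neg (h_nat hz0) ((h_nat (div_ne_zero hq0 hz0)).congr fun n => ?_)
  rw [← thetaTerm_div_neg hq0 hz0 (-n), neg_neg]

/-- The Gaussian binomial coefficient, set to zero for `k > M`: the coefficients of the
`q`-binomial theorem. -/
noncomputable def gaussBinom (q : ℂ) (M k : ℕ) : ℂ :=
  if k ≤ M then qPoch q q M / (qPoch q q k * qPoch q q (M - k)) else 0

theorem gaussBinom_zero (hq : ‖q‖ < 1) (M : ℕ) : gaussBinom q M 0 = 1 := by
  simp [gaussBinom, qPoch_zero, div_self (qPoch_self_ne_zero hq M)]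

theorem gaussBinom_succ_succ (hq : ‖q‖ < 1) (k l : ℕ) :
    gaussBinom q (k + l + 1) (k + 1)
      = gaussBinom q (k + l) (k + 1) + q ^ l * gaussBinom q (k + l) k := by
  have n1 := qPoch_self_ne_zero hq k
  have n2 := qPoch_self_ne_zero hq l
  have n3 := one_sub_mul_pow_ne_zero hq hq.le k
  have n4 := one_sub_mul_pow_ne_zero hq hq.le l
  rw [gaussBinom, gaussBinom, gaussBinom, if_pos (by omega), if_pos (by omega : k ≤ k + l),
    show k + l + 1 - (k + 1) = l by omega, Nat.add_sub_cancel_left]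
  rcases l with _ | l
  · have n5 := one_sub_mul_pow_ne_zero hq hq.le (k + 0)
    rw [if_neg (by omega), qPoch_succ, qPoch_zero]
    simp only [add_zero, pow_zero] at n5 ⊢
    field_simp
    ring
  · have n5 := qPoch_self_ne_zero hq l
    have n6 := one_sub_mul_pow_ne_zero hq hq.le l
    rw [if_pos (by omega), show k + (l + 1) - (k + 1) = l by omega, qPoch_succ _ _ (k + (l + 1)),
      qPoch_succ _ _ k, qPoch_succ _ _ l, pow_add q k, pow_succ q l]
    generalize qPoch q q (k + (l + 1)) = A, qPoch q q k = B, qPoch q q l = C, q ^ k = x,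
      q ^ l = y at *
    field_simp
    ring

theorem qPoch_eq_sum_gaussBinom (hq : ‖q‖ < 1) (x : ℂ) (M : ℕ) :
    qPoch x q M = ∑ k ∈ range (M + 1), (-1) ^ k * q ^ k.choose 2 * x ^ k * gaussBinom q M k := by
  induction M with
  | zero => simp [gaussBinom, qPoch_zero]
  | succ M ih =>
    have h : ∀ k ∈ range (M + 1), (-1) ^ (k + 1) * q ^ (k + 1).choose 2 * x ^ (k + 1)
        * gaussBinom q (M + 1) (k + 1)
        = (-1) ^ (k + 1) * q ^ (k + 1).choose 2 * x ^ (k + 1) * gaussBinom q M (k + 1)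
          - x * q ^ M * ((-1) ^ k * q ^ k.choose 2 * x ^ k * gaussBinom q M k) := fun k hk => by
      obtain ⟨l, rfl⟩ := Nat.exists_eq_add_of_le (Nat.lt_succ_iff.1 (mem_range.1 hk))
      rw [gaussBinom_succ_succ hq, Nat.choose_succ_succ' k 1, Nat.choose_one_right, pow_add q k,
        pow_add q k]
      ring
    have h0 : ∑ k ∈ range (M + 1), (-1) ^ (k + 1) * q ^ (k + 1).choose 2 * x ^ (k + 1)
        * gaussBinom q M (k + 1) + 1 = qPoch x q M := by
      have h1 := sum_range_succ' (fun k => (-1) ^ k * q ^ k.choose 2 * x ^ k * gaussBinom q M k)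
        (M + 1)
      rw [sum_range_succ, ← ih] at h1
      simpa [gaussBinom, qPoch_zero, div_self (qPoch_self_ne_zero hq M)] using h1.symm
    rw [sum_range_succ', sum_congr rfl h, sum_sub_distrib, ← mul_sum, ← ih, qPoch_succ, ← h0]
    simp [gaussBinom_zero hq]
    ring

theorem qPoch_mul_inv_pow (hq0 : q ≠ 0) (hz0 : z ≠ 0) (N : ℕ) :
    qPoch (z * (q ^ N)⁻¹) q N * q ^ (N + 1).choose 2 = (-1) ^ N * z ^ N * qPoch (q / z) q N := by
  induction N with
  | zero => simp [qPoch_zero]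
  | succ N ih =>
    have h1 : qPoch (z * (q ^ (N + 1))⁻¹) q (N + 1)
        = (1 - z * (q ^ (N + 1))⁻¹) * qPoch (z * (q ^ N)⁻¹) q N := by
      rw [add_comm N 1, qPoch_add, pow_one]
      congr 1
      · simp [qPoch]
      · congr 1
        rw [pow_add]; field_simp
    rw [h1, Nat.choose_succ_succ' (N + 1) 1, Nat.choose_one_right, qPoch_succ, pow_add]
    have h2 : (1 - z * (q ^ (N + 1))⁻¹) * q ^ (N + 1) = -z * (1 - q / z * q ^ N) := by
      rw [pow_succ]; field_simp; ring
    linear_combination (1 - z * (q ^ (N + 1))⁻¹) * q ^ (N + 1) * ih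
      + (-1) ^ N * z ^ N * qPoch (q / z) q N * h2

theorem neg_one_pow_mul_pow_choose_two_mul_pow (hq0 : q ≠ 0) (hz0 : z ≠ 0) (N k : ℕ) :
    (-1) ^ k * q ^ k.choose 2 * (z * (q ^ N)⁻¹) ^ k
      = (-1) ^ N * z ^ N * (q ^ (N + 1).choose 2)⁻¹ * thetaTerm q z (k - N) := by
  have h_exp : (k.choose 2 : ℤ) - N * k = -((N + 1).choose 2 : ℕ) + chooseTwo (k - N) := by
    rw [natCast_choose_two, natCast_choose_two]
    have h := two_mul_chooseTwo ((N + 1 : ℕ) : ℤ)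
    push_cast at *
    linarith [two_mul_chooseTwo (k - N), two_mul_chooseTwo k]
  have hq_pow : q ^ k.choose 2 * ((q ^ N)⁻¹) ^ k
      = (q ^ (N + 1).choose 2)⁻¹ * q ^ chooseTwo (k - N) := by
    have := congrArg (fun n : ℤ => q ^ n) h_exp
    rw [zpow_sub₀ hq0, zpow_add₀ hq0, zpow_neg, zpow_natCast, zpow_natCast, zpow_mul,
      zpow_natCast, zpow_natCast] at this
    rw [inv_pow, ← this]; rfl
  have h_split {w : ℂ} (hw : w ≠ 0) : w ^ k = w ^ N * w ^ ((k : ℤ) - N) := by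
    rw [← zpow_natCast, ← zpow_natCast, ← zpow_add₀ hw, add_sub_cancel]
  rw [thetaTerm, mul_pow, h_split (w := -1) (by norm_num), h_split hz0]
  linear_combination (-1) ^ N * (-1) ^ ((k : ℤ) - N) * (z ^ N * z ^ ((k : ℤ) - N)) * hq_pow

/-- The finite form of the triple product identity: the `q`-binomial theorem for `2 N` factors
starting at `z * q ^ (-N)`. -/
theorem qPoch_mul_qPoch_div (hq0 : q ≠ 0) (hq : ‖q‖ < 1) (hz0 : z ≠ 0) (N : ℕ) :
    qPoch z q N * qPoch (q / z) q N
      = ∑ n ∈ Icc (-N : ℤ) N, thetaTerm q z n * gaussBinom q (2 * N) (n + N).toNat := by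
  have h_binom := qPoch_eq_sum_gaussBinom hq (z * (q ^ N)⁻¹) (2 * N)
  have h_refl := qPoch_mul_inv_pow hq0 hz0 N
  rw [two_mul, qPoch_add, inv_mul_cancel_right₀ (pow_ne_zero N hq0), ← two_mul] at h_binom
  have h_shift : ∑ k ∈ range (2 * N + 1), (-1) ^ k * q ^ k.choose 2 * (z * (q ^ N)⁻¹) ^ k
      * gaussBinom q (2 * N) k = (-1) ^ N * z ^ N * (q ^ (N + 1).choose 2)⁻¹
        * ∑ n ∈ Icc (-N : ℤ) N, thetaTerm q z n * gaussBinom q (2 * N) (n + N).toNat := by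
    rw [mul_sum]
    refine sum_nbij' (fun k => (k : ℤ) - N) (fun n => (n + N).toNat) ?_ ?_ ?_ ?_ fun k _ => ?_
    · intro k hk; rw [mem_range] at hk; rw [mem_Icc]; omega
    · intro n hn; rw [mem_Icc] at hn; rw [mem_range]; omega
    · intro k _; simp
    · intro n hn; rw [mem_Icc] at hn; omega
    · rw [neg_one_pow_mul_pow_choose_two_mul_pow hq0 hz0, sub_add_cancel, Int.toNat_natCast,
        mul_assoc]
  rw [h_shift] at h_binom
  have hqN : q ^ (N + 1).choose 2 ≠ 0 := pow_ne_zero _ hq0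
  refine mul_left_cancel₀ (mul_ne_zero (pow_ne_zero N (neg_ne_zero.2 one_ne_zero))
    (pow_ne_zero N hz0)) ?_
  calc (-1) ^ N * z ^ N * (qPoch z q N * qPoch (q / z) q N)
      = qPoch (z * (q ^ N)⁻¹) q N * qPoch z q N * q ^ (N + 1).choose 2 := by
        linear_combination -qPoch z q N * h_refl
    _ = _ := by rw [h_binom]; field_simp

theorem exists_norm_gaussBinom_le (hq : ‖q‖ < 1) :
    ∃ C : ℝ, 0 < C ∧ ∀ M k, ‖gaussBinom q M k‖ ≤ C := by
  obtain ⟨A, hA, hA'⟩ := exists_norm_qPoch_le q hq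
  obtain ⟨B, hB, hB'⟩ := exists_norm_inv_qPoch_le hq (one_sub_mul_pow_ne_zero hq hq.le)
  refine ⟨A * B * B, by positivity, fun M k => ?_⟩
  rw [gaussBinom]
  split_ifs
  · rw [div_eq_mul_inv, mul_inv, norm_mul, norm_mul, ← mul_assoc]
    gcongr
    exacts [hA' _, hB' _, hB' _]
  · rw [norm_zero]; positivity

theorem tendsto_gaussBinom_two_mul (hq : ‖q‖ < 1) (n : ℤ) :
    Tendsto (fun N : ℕ => gaussBinom q (2 * N) (n + N).toNat) atTop (𝓝 (qPochInf q q)⁻¹) := by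
  have h_ne := qPochInf_ne_zero hq (one_sub_mul_pow_ne_zero hq hq.le)
  have h_top {f : ℕ → ℕ} (h : ∀ N, n.natAbs ≤ N → N - n.natAbs ≤ f N) :
      Tendsto (fun N => qPoch q q (f N)) atTop (𝓝 (qPochInf q q)) :=
    (tendsto_qPoch q hq).comp <|
      tendsto_atTop_mono' _ (eventually_atTop.2 ⟨_, h⟩) (tendsto_sub_atTop_nat n.natAbs)
  have key := (h_top (f := fun N => 2 * N) fun N _ => by omega).div
    ((h_top (f := fun N => (n + N).toNat) fun N _ => by omega).mul
      (h_top (f := fun N => 2 * N - (n + N).toNat) fun N _ => by omega)) (mul_ne_zero h_ne h_ne)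
  rw [div_mul_cancel_left₀ h_ne] at key
  refine key.congr' (eventually_atTop.2 ⟨n.natAbs, fun N hN => ?_⟩)
  exact (if_pos (by omega : (n + N).toNat ≤ 2 * N)).symm

theorem thetaSum_eq_qPochInf (hq0 : q ≠ 0) (hq : ‖q‖ < 1) (hz0 : z ≠ 0) :
    thetaSum q z = qPochInf q q * qPochInf z q * qPochInf (q / z) q := by
  have h_ne := qPochInf_ne_zero hq (one_sub_mul_pow_ne_zero hq hq.le)
  obtain ⟨C, hC, hC'⟩ := exists_norm_gaussBinom_le hq
  have h_lim : Tendsto (fun N : ℕ => ∑' n : ℤ, if n ∈ Icc (-N : ℤ) N then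
      thetaTerm q z n * gaussBinom q (2 * N) (n + N).toNat else 0) atTop
      (𝓝 (∑' n : ℤ, thetaTerm q z n * (qPochInf q q)⁻¹)) := by
    refine tendsto_tsum_of_dominated_convergence (bound := fun n => ‖thetaTerm q z n‖ * C)
      ((summable_norm_thetaTerm hq0 hq hz0).mul_right _) (fun n => ?_)
      (.of_forall fun N n => ?_)
    · refine ((tendsto_gaussBinom_two_mul hq n).const_mul (thetaTerm q z n)).congr'
        (eventually_atTop.2 ⟨n.natAbs, fun N hN => ?_⟩)
      exact (if_pos (by rw [mem_Icc]; omega)).symm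
    · split_ifs
      · rw [norm_mul]; gcongr; exact hC' _ _
      · rw [norm_zero]; positivity
  have h_prod (N : ℕ) : qPoch z q N * qPoch (q / z) q N = ∑' n : ℤ, if n ∈ Icc (-N : ℤ) N then
      thetaTerm q z n * gaussBinom q (2 * N) (n + N).toNat else 0 := by
    rw [qPoch_mul_qPoch_div hq0 hq hz0, tsum_eq_sum fun n hn => if_neg hn]
    exact (sum_congr rfl fun n hn => if_pos hn).symm
  have h_eq := tendsto_nhds_unique (h_lim.congr fun N => (h_prod N).symm)
    ((tendsto_qPoch z hq).mul (tendsto_qPoch (q / z) hq))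
  rw [tsum_mul_right, ← div_eq_mul_inv, div_eq_iff h_ne] at h_eq
  rw [thetaSum, h_eq]
  ring

end TripleProduct

section ThetaCube

variable {q z : ℂ}

theorem chooseTwo_add (k l : ℤ) : chooseTwo (k + l) = chooseTwo k + chooseTwo l + k * l := by
  linarith [two_mul_chooseTwo (k + l), two_mul_chooseTwo k, two_mul_chooseTwo l]

theorem chooseTwo_one_sub (l : ℤ) : chooseTwo (1 - l) = chooseTwo l := by
  linarith [two_mul_chooseTwo (1 - l), two_mul_chooseTwo l]

/-- The product of the coefficients of `z ^ x.1`, `z ^ x.2` and `z ^ (s - x.1 - x.2)` in Jacobi's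
theta series: one contribution to the coefficient of `z ^ s` in its cube. -/
noncomputable def thetaCubeTerm (q : ℂ) (s : ℤ) (x : ℤ × ℤ) : ℂ :=
  (-1) ^ s * q ^ (chooseTwo x.1 + chooseTwo x.2 + chooseTwo (s - x.1 - x.2))

/-- The coefficient of `z ^ s` in the cube of Jacobi's theta series. -/
noncomputable def thetaCubeCoeff (q : ℂ) (s : ℤ) : ℂ := ∑' x, thetaCubeTerm q s x

theorem thetaCubeTerm_zero (q : ℂ) : thetaCubeTerm q 0 = cubicThetaTerm q := by
  funext x
  have h_exp : chooseTwo x.1 + chooseTwo x.2 + chooseTwo (0 - x.1 - x.2)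
      = x.1 ^ 2 + x.1 * x.2 + x.2 ^ 2 := by
    linarith [two_mul_chooseTwo x.1, two_mul_chooseTwo x.2, two_mul_chooseTwo (0 - x.1 - x.2)]
  rw [thetaCubeTerm, cubicThetaTerm, h_exp, zpow_zero, one_mul]

theorem thetaCubeCoeff_zero (q : ℂ) : thetaCubeCoeff q 0 = cubicTheta q := by
  rw [thetaCubeCoeff, thetaCubeTerm_zero, cubicTheta]

theorem thetaCubeCoeff_three_mul_add (hq0 : q ≠ 0) (k j : ℤ) :
    thetaCubeCoeff q (3 * k + j)
      = (-1) ^ k * q ^ (3 * chooseTwo k + k * j) * thetaCubeCoeff q j := by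
  rw [thetaCubeCoeff, thetaCubeCoeff, ← tsum_mul_left,
    ← ((Equiv.addLeft k).prodCongr (Equiv.addLeft k)).tsum_eq]
  refine tsum_congr fun x => ?_
  have h_exp : chooseTwo (k + x.1) + chooseTwo (k + x.2)
        + chooseTwo (3 * k + j - (k + x.1) - (k + x.2))
      = 3 * chooseTwo k + k * j + (chooseTwo x.1 + chooseTwo x.2 + chooseTwo (j - x.1 - x.2)) := by
    rw [show 3 * k + j - (k + x.1) - (k + x.2) = k + (j - x.1 - x.2) by ring, chooseTwo_add,
      chooseTwo_add, chooseTwo_add]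
    ring
  have h_sign : (-1 : ℂ) ^ (3 * k + j) = (-1) ^ k * (-1) ^ j := by
    rw [zpow_add₀ (by norm_num), zpow_mul]; norm_num
  simp only [thetaCubeTerm, Equiv.prodCongr_apply, Prod.map_fst, Prod.map_snd, Equiv.coe_addLeft]
  rw [h_exp, h_sign, zpow_add₀ hq0 (3 * chooseTwo k + k * j)]
  ring

theorem thetaCubeCoeff_two (q : ℂ) : thetaCubeCoeff q 2 = -thetaCubeCoeff q 1 := by
  rw [thetaCubeCoeff, thetaCubeCoeff, ← tsum_neg,
    ← ((Equiv.subLeft (1 : ℤ)).prodCongr (Equiv.subLeft (1 : ℤ))).tsum_eq]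
  refine tsum_congr fun x => ?_
  simp only [thetaCubeTerm, Equiv.prodCongr_apply, Prod.map_fst, Prod.map_snd,
    Equiv.subLeft_apply]
  rw [show (2 : ℤ) - (1 - x.1) - (1 - x.2) = 1 - (1 - x.1 - x.2) by ring,
    chooseTwo_one_sub, chooseTwo_one_sub, chooseTwo_one_sub]
  norm_num

/-- The reindexing of `ℤ³` by the sum of the three entries and the first two of them. -/
def tripleSumEquiv : ℤ × (ℤ × ℤ) ≃ (ℤ × ℤ) × ℤ where
  toFun x := (x.2, x.1 - x.2.1 - x.2.2)
  invFun y := (y.2 + y.1.1 + y.1.2, y.1)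
  left_inv x := by ext <;> dsimp; ring
  right_inv y := by ext <;> dsimp; ring

theorem thetaTerm_mul_mul (hq0 : q ≠ 0) (hz0 : z ≠ 0) (x : ℤ × (ℤ × ℤ)) :
    thetaTerm q z x.2.1 * thetaTerm q z x.2.2 * thetaTerm q z (x.1 - x.2.1 - x.2.2)
      = thetaCubeTerm q x.1 x.2 * z ^ x.1 := by
  have h_split (w : ℂ) (hw : w ≠ 0) :
      w ^ x.1 = w ^ x.2.1 * w ^ x.2.2 * w ^ (x.1 - x.2.1 - x.2.2) := by
    rw [← zpow_add₀ hw, ← zpow_add₀ hw]; congr 1; ring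
  rw [thetaCubeTerm, h_split z hz0, h_split (-1) (by norm_num), zpow_add₀ hq0, zpow_add₀ hq0]
  simp only [thetaTerm]
  ring

theorem summable_thetaCubeTerm_mul_zpow (hq0 : q ≠ 0) (hq : ‖q‖ < 1) (hz0 : z ≠ 0) :
    Summable fun x : ℤ × (ℤ × ℤ) => thetaCubeTerm q x.1 x.2 * z ^ x.1 := by
  have h := summable_norm_thetaTerm hq0 hq hz0
  refine (tripleSumEquiv.summable_iff.2 ((h.mul_norm h).mul_norm h).of_norm).congr fun x => ?_
  exact thetaTerm_mul_mul hq0 hz0 x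

theorem summable_cubicThetaTerm (hq0 : q ≠ 0) (hq : ‖q‖ < 1) : Summable (cubicThetaTerm q) := by
  rw [← thetaCubeTerm_zero]
  simpa using (summable_thetaCubeTerm_mul_zpow hq0 hq one_ne_zero).prod_factor 0

theorem summable_thetaCubeCoeff_mul_zpow (hq0 : q ≠ 0) (hq : ‖q‖ < 1) (hz0 : z ≠ 0) :
    Summable fun s => thetaCubeCoeff q s * z ^ s :=
  (summable_thetaCubeTerm_mul_zpow hq0 hq hz0).prod.congr fun s => tsum_mul_right (a := z ^ s)

theorem thetaSum_pow_three_eq_tsum (hq0 : q ≠ 0) (hq : ‖q‖ < 1) (hz0 : z ≠ 0) :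
    thetaSum q z ^ 3 = ∑' s, thetaCubeCoeff q s * z ^ s := by
  have h := summable_norm_thetaTerm hq0 hq hz0
  calc thetaSum q z ^ 3
      = ∑' x : (ℤ × ℤ) × ℤ, thetaTerm q z x.1.1 * thetaTerm q z x.1.2 * thetaTerm q z x.2 := by
        rw [pow_succ, sq, thetaSum, tsum_mul_tsum_of_summable_norm h h,
          tsum_mul_tsum_of_summable_norm (h.mul_norm h) h]
    _ = ∑' x : ℤ × (ℤ × ℤ), thetaCubeTerm q x.1 x.2 * z ^ x.1 := by
        rw [← tripleSumEquiv.tsum_eq]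
        exact tsum_congr (thetaTerm_mul_mul hq0 hz0)
    _ = ∑' s, thetaCubeCoeff q s * z ^ s := by
        rw [(summable_thetaCubeTerm_mul_zpow hq0 hq hz0).tsum_prod]
        exact tsum_congr fun s => tsum_mul_right (a := z ^ s)

theorem tsum_int_eq_tsum_three {f : ℤ → ℂ} (hf : Summable f) :
    ∑' n, f n = ∑' k, f (3 * k) + ∑' k, f (3 * k + 1) + ∑' k, f (3 * k + 2) := by
  have h_class (j : ℤ) : Summable fun k : ℤ => f (3 * k + j) :=
    hf.comp_injective (i := fun k : ℤ => 3 * k + j) fun a b h => by simp only at h; omega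
  have h0 : Summable fun k : ℤ => f (3 * k) := by simpa only [add_zero] using h_class 0
  rw [← (Int.divModEquiv 3).symm.tsum_eq, ← h0.tsum_add (h_class 1),
    ← (h0.add (h_class 1)).tsum_add (h_class 2)]
  refine ((Int.divModEquiv 3).symm.summable_iff.2 hf).tsum_prod.trans ?_
  refine tsum_congr fun k => ?_
  rw [tsum_fintype, Fin.sum_univ_three]
  simp [Int.divModEquiv, mul_comm]

theorem thetaCubeCoeff_three_mul_add_mul_zpow (hq0 : q ≠ 0) (hz0 : z ≠ 0) (j : ℕ) (k : ℤ) :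
    thetaCubeCoeff q (3 * k + j) * z ^ (3 * k + j)
      = thetaCubeCoeff q j * z ^ j * thetaTerm (q ^ 3) (q ^ j * z ^ 3) k := by
  rw [thetaCubeCoeff_three_mul_add hq0, zpow_add₀ hq0, zpow_add₀ hz0, thetaTerm, mul_zpow,
    zpow_mul q 3, zpow_mul z 3, mul_comm k, zpow_mul q j]
  simp only [zpow_natCast]
  norm_cast
  ring

theorem thetaSum_pow_three (hq0 : q ≠ 0) (hq : ‖q‖ < 1) (hz0 : z ≠ 0) :
    thetaSum q z ^ 3 = cubicTheta q * thetaSum (q ^ 3) (z ^ 3)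
      + thetaCubeCoeff q 1 * (z * thetaSum (q ^ 3) (q * z ^ 3)
        - z ^ 2 * thetaSum (q ^ 3) (q ^ 2 * z ^ 3)) := by
  have h_summable := summable_thetaCubeCoeff_mul_zpow hq0 hq hz0
  have h_class (j : ℕ) : ∑' k : ℤ, thetaCubeCoeff q (3 * k + j) * z ^ (3 * k + j)
      = thetaCubeCoeff q j * z ^ j * thetaSum (q ^ 3) (q ^ j * z ^ 3) := by
    rw [tsum_congr (thetaCubeCoeff_three_mul_add_mul_zpow hq0 hz0 j), tsum_mul_left, thetaSum]
  have h0 := h_class 0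
  have h1 := h_class 1
  have h2 := h_class 2
  simp only [Nat.cast_zero, Nat.cast_one, Nat.cast_ofNat, add_zero, pow_zero, one_mul, pow_one,
    mul_one] at h0 h1 h2
  rw [thetaSum_pow_three_eq_tsum hq0 hq hz0, tsum_int_eq_tsum_three h_summable, h0, h1, h2,
    thetaCubeCoeff_zero, thetaCubeCoeff_two]
  ring

end ThetaCube

section Lambert

variable {p x : ℂ}

/-- The Lambert series `∑_{i ≥ 0} x p ^ i / (1 - x p ^ i)`, which is minus the logarithmic
derivative `x ∂/∂x` of `(x; p)_∞`. -/
noncomputable def lambertSum (x p : ℂ) : ℂ := ∑' i : ℕ, x * p ^ i / (1 - x * p ^ i)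

theorem summable_mul_pow_div_one_sub (x : ℂ) (hp : ‖p‖ < 1) :
    Summable fun i : ℕ => x * p ^ i / (1 - x * p ^ i) := by
  have h_lim : Tendsto (fun i : ℕ => (1 - x * p ^ i)⁻¹) atTop (𝓝 1) := by
    simpa using (((tendsto_pow_atTop_nhds_zero_of_norm_lt_one hp).const_mul x).const_sub 1).inv₀
      (by simp)
  obtain ⟨C, -, hC⟩ := exists_norm_le_of_tendsto h_lim
  refine .of_norm_bounded ((summable_norm_mul_pow x hp).mul_right C) fun i => ?_
  rw [div_eq_mul_inv, norm_mul]
  gcongr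
  exact hC i

theorem lambertSum_sub_lambertSum (b : ℂ) (hp : ‖p‖ < 1) (hx : ‖x‖ < 1)
    (hxb : ∀ i : ℕ, 1 - x * b * p ^ i ≠ 0) :
    lambertSum x p - lambertSum (x * b) p = ∑' j, gaussLogTerm b x p j :=
  tendsto_nhds_unique
    ((summable_mul_pow_div_one_sub x hp).hasSum.sub
      (summable_mul_pow_div_one_sub (x * b) hp).hasSum).tendsto_sum_nat
    (tendsto_sum_lambert b hp hx hxb)

theorem multipliableLocallyUniformlyOn_one_sub_mul_pow (hp : ‖p‖ < 1) (R : ℝ) :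
    MultipliableLocallyUniformlyOn (fun (i : ℕ) (y : ℂ) => 1 - y * p ^ i) (Metric.ball 0 R) := by
  have h := ((summable_geometric_of_lt_one (norm_nonneg p) hp).mul_left
    R).multipliableLocallyUniformlyOn_nat_one_add (f := fun i y => -(y * p ^ i))
    (K := Metric.ball (0 : ℂ) R) Metric.isOpen_ball (.of_forall fun i y hy => by
      rw [norm_neg, norm_mul, norm_pow]
      gcongr
      exact (mem_ball_zero_iff.1 hy).le) (fun i => by fun_prop)
  simpa only [sub_eq_add_neg] using h

theorem differentiable_qPochInf (hp : ‖p‖ < 1) : Differentiable ℂ fun y => qPochInf y p := fun x =>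
  ((multipliableLocallyUniformlyOn_one_sub_mul_pow hp
    (‖x‖ + 1)).hasProdLocallyUniformlyOn.differentiableOn (.of_forall fun s => by fun_prop)
      Metric.isOpen_ball).differentiableAt (Metric.isOpen_ball.mem_nhds (by simp))

theorem logDeriv_one_sub_mul (c x : ℂ) :
    logDeriv (fun y : ℂ => 1 - y * c) x = -(c / (1 - x * c)) := by
  have h : HasDerivAt (fun y : ℂ => 1 - y * c) (-(1 * c)) x :=
    ((hasDerivAt_id x).mul_const c).const_sub 1
  rw [logDeriv_apply, h.deriv, one_mul, neg_div]

theorem hasDerivAt_qPochInf (hp : ‖p‖ < 1) (hx0 : x ≠ 0) (hx : ∀ i : ℕ, 1 - x * p ^ i ≠ 0) :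
    HasDerivAt (fun y => qPochInf y p) (-(qPochInf x p * lambertSum x p / x)) x := by
  have h_term (i : ℕ) : logDeriv (fun y : ℂ => 1 - y * p ^ i) x
      = -x⁻¹ * (x * p ^ i / (1 - x * p ^ i)) := by
    rw [logDeriv_one_sub_mul]
    field_simp
  have h_ne := qPochInf_ne_zero hp hx
  have h_log : logDeriv (fun y => qPochInf y p) x
      = ∑' i : ℕ, logDeriv (fun y : ℂ => 1 - y * p ^ i) x := by
    refine logDeriv_tprod_eq_tsum Metric.isOpen_ball (s := Metric.ball 0 (‖x‖ + 1)) (by simp) hx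
      (fun i => by fun_prop) ?_ (multipliableLocallyUniformlyOn_one_sub_mul_pow hp _) h_ne
    simpa only [h_term] using (summable_mul_pow_div_one_sub x hp).mul_left (-x⁻¹)
  rw [tsum_congr h_term, tsum_mul_left, ← lambertSum, logDeriv_apply, div_eq_iff h_ne] at h_log
  refine (differentiable_qPochInf hp x).hasDerivAt.congr_deriv ?_
  rw [h_log]
  ring

end Lambert

section CubicTheta

variable {p q x : ℂ}

theorem hasDerivAt_const_div (c : ℂ) (hx0 : x ≠ 0) :
    HasDerivAt (fun y => c / y) (-(c / x ^ 2)) x := by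
  simpa [div_eq_mul_inv] using (hasDerivAt_inv hx0).const_mul c

theorem hasDerivAt_thetaSum (hp0 : p ≠ 0) (hp : ‖p‖ < 1) (hx0 : x ≠ 0)
    (hx : ∀ i : ℕ, 1 - x * p ^ i ≠ 0) (hpx : ∀ i : ℕ, 1 - p / x * p ^ i ≠ 0) :
    HasDerivAt (thetaSum p)
      (thetaSum p x * (lambertSum (p / x) p - lambertSum x p) / x) x := by
  have h_prod := ((hasDerivAt_qPochInf hp hx0 hx).const_mul (qPochInf p p)).mul
    ((hasDerivAt_qPochInf hp (div_ne_zero hp0 hx0) hpx).comp x (hasDerivAt_const_div p hx0))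
  have h_eq : thetaSum p =ᶠ[𝓝 x] fun y => qPochInf p p * qPochInf y p * qPochInf (p / y) p := by
    filter_upwards [isOpen_ne.mem_nhds hx0] with y hy
    exact thetaSum_eq_qPochInf hp0 hp hy
  refine (h_prod.congr_of_eventuallyEq h_eq).congr_deriv ?_
  rw [thetaSum_eq_qPochInf hp0 hp hx0]
  simp only [Function.comp_apply]
  field_simp
  ring

theorem thetaSum_eq_one_sub_mul (hp0 : p ≠ 0) (hp : ‖p‖ < 1) (hx0 : x ≠ 0) :
    thetaSum p x = (1 - x) * (qPochInf p p * qPochInf (x * p) p * qPochInf (p / x) p) := by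
  rw [thetaSum_eq_qPochInf hp0 hp hx0, qPochInf_eq_mul x hp 1, qPoch_succ, qPoch_zero]
  simp only [pow_zero, pow_one, mul_one, one_mul]
  ring

theorem thetaSum_one (hp0 : p ≠ 0) (hp : ‖p‖ < 1) : thetaSum p 1 = 0 := by
  rw [thetaSum_eq_one_sub_mul hp0 hp one_ne_zero, sub_self, zero_mul]

theorem hasDerivAt_thetaSum_one (hp0 : p ≠ 0) (hp : ‖p‖ < 1) :
    HasDerivAt (thetaSum p) (-qPochInf p p ^ 3) 1 := by
  have h_diff : DifferentiableAt ℂ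
      (fun y => qPochInf p p * qPochInf (y * p) p * qPochInf (p / y) p) 1 := by
    have h := differentiable_qPochInf hp
    have h_div : DifferentiableAt ℂ (fun y => p / y) 1 :=
      (hasDerivAt_const_div p one_ne_zero).differentiableAt
    exact (((h _).comp 1 (by fun_prop : DifferentiableAt ℂ (fun y => y * p) 1)).const_mul _).mul
      ((h _).comp 1 h_div)
  have h_eq : thetaSum p =ᶠ[𝓝 1]
      fun y => (1 - y) * (qPochInf p p * qPochInf (y * p) p * qPochInf (p / y) p) := by
    filter_upwards [isOpen_ne.mem_nhds one_ne_zero] with y hy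
    exact thetaSum_eq_one_sub_mul hp0 hp hy
  refine ((((hasDerivAt_id (1 : ℂ)).const_sub 1).mul h_diff.hasDerivAt).congr_of_eventuallyEq
    h_eq).congr_deriv ?_
  simp only [id, sub_self, zero_mul, add_zero, one_mul, div_one]
  ring

theorem qPochInf_mul_qPochInf_mul_qPochInf {w : ℂ} (hw : 1 + w + w ^ 2 = 0) (hq : ‖q‖ < 1) :
    qPochInf q q * qPochInf (w * q) q * qPochInf (w ^ 2 * q) q = qPochInf (q ^ 3) (q ^ 3) := by
  refine tendsto_nhds_unique (((tendsto_qPoch q hq).mul (tendsto_qPoch (w * q) hq)).mul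
    (tendsto_qPoch (w ^ 2 * q) hq)) ((tendsto_qPoch (q ^ 3)
      (norm_pow_lt_one hq three_ne_zero)).congr fun n => ?_)
  simp only [qPoch, ← prod_mul_distrib]
  refine prod_congr rfl fun i _ => ?_
  rw [← pow_mul, mul_comm 3 i, pow_mul]
  generalize q ^ i = y
  linear_combination (q * y - w * (q * y) ^ 2 + (q * y) ^ 3 * (w - 1)) * hw

theorem thetaSum_of_isPrimitiveRoot {w : ℂ} (hw : IsPrimitiveRoot w 3) (hq0 : q ≠ 0)
    (hq : ‖q‖ < 1) : thetaSum q w = (1 - w) * qPochInf (q ^ 3) (q ^ 3) := by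
  have hw0 : w ≠ 0 := hw.ne_zero (by norm_num)
  have h_inv : q / w = w ^ 2 * q := by field_simp; linear_combination -hw.pow_eq_one
  have h_sum : 1 + w + w ^ 2 = 0 := by
    simpa [sum_range_succ] using hw.geom_sum_eq_zero (by norm_num)
  rw [thetaSum_eq_one_sub_mul hq0 hq hw0, h_inv,
    qPochInf_mul_qPochInf_mul_qPochInf h_sum hq]

theorem thetaSum_cube_sq (hq0 : q ≠ 0) : thetaSum (q ^ 3) (q ^ 2) = thetaSum (q ^ 3) q := by
  rw [← thetaSum_div (pow_ne_zero 3 hq0) hq0]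
  congr 1
  field_simp

theorem thetaCubeCoeff_one_mul_thetaSum (hq0 : q ≠ 0) (hq : ‖q‖ < 1) :
    thetaCubeCoeff q 1 * thetaSum (q ^ 3) q = -3 * qPochInf (q ^ 3) (q ^ 3) ^ 3 := by
  obtain ⟨w, hw⟩ : ∃ w : ℂ, IsPrimitiveRoot w 3 := ⟨_, Complex.isPrimitiveRoot_exp 3 (by norm_num)⟩
  have hw0 : w ≠ 0 := hw.ne_zero (by norm_num)
  have key := thetaSum_pow_three hq0 hq hw0
  rw [hw.pow_eq_one, mul_one, mul_one,
    thetaSum_one (pow_ne_zero 3 hq0) (norm_pow_lt_one hq three_ne_zero), thetaSum_cube_sq hq0,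
    thetaSum_of_isPrimitiveRoot hw hq0 hq] at key
  have h_ne : w * (1 - w) ≠ 0 :=
    mul_ne_zero hw0 (sub_ne_zero.2 (hw.ne_one (by norm_num)).symm)
  refine mul_left_cancel₀ h_ne ?_
  linear_combination -key - qPochInf (q ^ 3) (q ^ 3) ^ 3 * hw.pow_eq_one

theorem hasDerivAt_thetaSum_cube_self (hq0 : q ≠ 0) (hq : ‖q‖ < 1) :
    HasDerivAt (thetaSum (q ^ 3))
      (thetaSum (q ^ 3) q * (lambertSum (q ^ 2) (q ^ 3) - lambertSum q (q ^ 3)) / q) q := by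
  have hp := norm_pow_lt_one hq three_ne_zero
  have h_div : q ^ 3 / q = q ^ 2 := by field_simp
  rw [← h_div]
  refine hasDerivAt_thetaSum (pow_ne_zero 3 hq0) hp hq0 (one_sub_mul_pow_ne_zero hq hp.le) ?_
  rw [h_div]
  exact one_sub_mul_pow_ne_zero (norm_pow_lt_one hq two_ne_zero) hp.le

theorem hasDerivAt_thetaSum_cube_sq (hq0 : q ≠ 0) (hq : ‖q‖ < 1) :
    HasDerivAt (thetaSum (q ^ 3))
      (thetaSum (q ^ 3) q * (lambertSum q (q ^ 3) - lambertSum (q ^ 2) (q ^ 3)) / q ^ 2)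
      (q ^ 2) := by
  have hp := norm_pow_lt_one hq three_ne_zero
  have h_div : q ^ 3 / q ^ 2 = q := by field_simp
  have h := hasDerivAt_thetaSum (pow_ne_zero 3 hq0) hp (pow_ne_zero 2 hq0)
    (one_sub_mul_pow_ne_zero (norm_pow_lt_one hq two_ne_zero) hp.le)
    (h_div.symm ▸ one_sub_mul_pow_ne_zero hq hp.le)
  rwa [h_div, thetaSum_cube_sq hq0] at h

theorem cubicTheta_eq_lambertSum (hq0 : q ≠ 0) (hq : ‖q‖ < 1) :
    cubicTheta q = 1 + 6 * (lambertSum q (q ^ 3) - lambertSum (q ^ 2) (q ^ 3)) := by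
  have hp0 : q ^ 3 ≠ 0 := pow_ne_zero 3 hq0
  have hp := norm_pow_lt_one hq three_ne_zero
  have h_cube : HasDerivAt (fun z : ℂ => z ^ 3) 3 1 := by simpa using hasDerivAt_pow 3 (1 : ℂ)
  have h_scaled {c d : ℂ} (h : HasDerivAt (thetaSum (q ^ 3)) d c) :
      HasDerivAt (fun z => thetaSum (q ^ 3) (c * z ^ 3)) (d * (c * 3)) 1 :=
    HasDerivAt.comp (h₂ := thetaSum (q ^ 3)) 1 (by simpa using h) (h_cube.const_mul c)
  have h_left := (hasDerivAt_thetaSum_one hq0 hq).pow 3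
  have h_right := ((h_scaled (hasDerivAt_thetaSum_one hp0 hp)).const_mul (cubicTheta q)).add
    ((((hasDerivAt_id (1 : ℂ)).mul (h_scaled (hasDerivAt_thetaSum_cube_self hq0 hq))).sub
      ((hasDerivAt_pow 2 (1 : ℂ)).mul
        (h_scaled (hasDerivAt_thetaSum_cube_sq hq0 hq)))).const_mul (thetaCubeCoeff q 1))
  have h_dissection := h_right.unique (h_left.congr_of_eventuallyEq ?_)
  · have h_coeff := thetaCubeCoeff_one_mul_thetaSum hq0 hq
    have h_ne := qPochInf_ne_zero hp (one_sub_mul_pow_ne_zero hp hp.le)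
    simp only [thetaSum_one hq0 hq, id, one_pow, mul_one, thetaSum_cube_sq hq0] at h_dissection
    field_simp at h_dissection
    refine mul_left_cancel₀ (mul_ne_zero three_ne_zero (pow_ne_zero 3 h_ne)) ?_
    linear_combination -h_dissection
      + (-1 - 6 * (lambertSum q (q ^ 3) - lambertSum (q ^ 2) (q ^ 3))) * h_coeff
  · filter_upwards [isOpen_ne.mem_nhds (one_ne_zero : (1 : ℂ) ≠ 0)] with z hz
    simpa using (thetaSum_pow_three hq0 hq hz).symm

theorem cubicTheta_eq_tsum_gaussLogTerm (hq0 : q ≠ 0) (hq : ‖q‖ < 1) :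
    cubicTheta q = 1 + 6 * ∑' j, gaussLogTerm q q (q ^ 3) j := by
  have hp := norm_pow_lt_one hq three_ne_zero
  have hq2 := one_sub_mul_pow_ne_zero (norm_pow_lt_one hq two_ne_zero) hp.le
  rw [cubicTheta_eq_lambertSum hq0 hq,
    ← lambertSum_sub_lambertSum q hp hq (by simpa only [sq] using hq2), sq]

end CubicTheta

section ThreeParameters

variable {a p b c d e s t : ℂ}

theorem exists_norm_jacksonFactor_le (hp : ‖p‖ < 1)
    (h : ∃ C : ℝ, ∀ m : ℕ,
      ‖∏ i ∈ range m, jacksonNum a p e s t (p ^ i) / jacksonDen a p e s t (p ^ i)‖ ≤ C) :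
    ∃ C : ℝ, ∀ m, ‖jacksonFactor a p e s t m‖ ≤ C := by
  obtain ⟨A, hA⟩ := h
  obtain ⟨B, hB, hB'⟩ := exists_norm_qPoch_le a hp
  obtain ⟨D, hD, hD'⟩ := exists_norm_inv_qPoch_le hp (one_sub_mul_pow_ne_zero hp hp.le)
  have h1 (m : ℕ) : ‖1 - a * p ^ (2 * m)‖ ≤ 1 + ‖a‖ := by
    refine (norm_sub_le _ _).trans ?_
    rw [norm_one]
    gcongr
    exact norm_mul_pow_le _ hp.le _
  refine ⟨(1 + ‖a‖) * (B * (‖(1 - a)⁻¹‖ * D) * A), fun m => ?_⟩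
  rw [jacksonFactor, jacksonCoeff, div_eq_mul_inv (qPoch a p m), mul_inv]
  simp only [norm_mul]
  gcongr
  exacts [h1 m, hB' m, hD' m, hA m]

theorem jacksonNum_eq_mul (hb : b ≠ 0) (hc : c ≠ 0) (hd : d ≠ 0) (h : b * c * d = a ^ 2 * p)
    (x : ℂ) :
    jacksonNum a p 1 (b + c + d) (a * p / b + a * p / c + a * p / d) x
      = (1 - b * x) * (1 - c * x) * (1 - d * x) := by
  have ht : a * (a * p / b + a * p / c + a * p / d) = b * c + b * d + c * d := by
    field_simp
    linear_combination -(b * c + b * d + c * d) * h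
  rw [jacksonNum]
  linear_combination x ^ 2 * ht + x ^ 3 * h

theorem jacksonDen_eq_mul (hb : b ≠ 0) (hc : c ≠ 0) (hd : d ≠ 0) (h : b * c * d = a ^ 2 * p)
    (x : ℂ) :
    jacksonDen a p 1 (b + c + d) (a * p / b + a * p / c + a * p / d) x
      = (1 - a * p / b * x) * (1 - a * p / c * x) * (1 - a * p / d * x) := by
  have hs : p * (b + c + d) = a * p / b * (a * p / c) + a * p / b * (a * p / d)
      + a * p / c * (a * p / d) := by
    field_simp
    linear_combination p * (b + c + d) * h
  have he : a * p ^ 2 = a * p / b * (a * p / c) * (a * p / d) := by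
    field_simp
    linear_combination a * p ^ 2 * h
  rw [jacksonDen]
  linear_combination x ^ 2 * hs - x ^ 3 * he

theorem prod_jacksonNum_div_jacksonDen (hb : b ≠ 0) (hc : c ≠ 0) (hd : d ≠ 0)
    (h : b * c * d = a ^ 2 * p) (m : ℕ) :
    ∏ i ∈ range m, jacksonNum a p 1 (b + c + d) (a * p / b + a * p / c + a * p / d) (p ^ i)
        / jacksonDen a p 1 (b + c + d) (a * p / b + a * p / c + a * p / d) (p ^ i)
      = qPoch b p m * qPoch c p m * qPoch d p m
        / (qPoch (a * p / b) p m * qPoch (a * p / c) p m * qPoch (a * p / d) p m) := by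
  simp only [jacksonNum_eq_mul hb hc hd h, jacksonDen_eq_mul hb hc hd h, prod_div_distrib,
    prod_mul_distrib, qPoch]

theorem jacksonSum_eq_div (hb : b ≠ 0) (hc : c ≠ 0) (hd : d ≠ 0) (h : b * c * d = a ^ 2 * p)
    (n : ℕ) :
    jacksonSum a p 1 (b + c + d) (a * p / b + a * p / c + a * p / d) n
      = qPoch (b / a) p n * qPoch (c / a) p n * qPoch (d / a) p n
        / (qPoch (a * p / b) p n * qPoch (a * p / c) p n * qPoch (a * p / d) p n) := by
  have shift (y : ℂ) : qPoch (y / a) p n = ∏ i ∈ range n, (1 - y * (p ^ i / a)) :=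
    prod_congr rfl fun i _ => by ring
  rw [shift b, shift c, shift d]
  simp only [jacksonSum, jacksonNum_eq_mul hb hc hd h, jacksonDen_eq_mul hb hc hd h,
    prod_div_distrib, prod_mul_distrib, qPoch]

theorem exists_norm_prod_jacksonNum_div_jacksonDen_le (hp : ‖p‖ < 1) (hb : b ≠ 0) (hc : c ≠ 0)
    (hd : d ≠ 0) (h : b * c * d = a ^ 2 * p) (hb' : ∀ i : ℕ, 1 - a * p / b * p ^ i ≠ 0)
    (hc' : ∀ i : ℕ, 1 - a * p / c * p ^ i ≠ 0) (hd' : ∀ i : ℕ, 1 - a * p / d * p ^ i ≠ 0) :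
    ∃ C : ℝ, ∀ m : ℕ, ‖∏ i ∈ range m,
      jacksonNum a p 1 (b + c + d) (a * p / b + a * p / c + a * p / d) (p ^ i)
        / jacksonDen a p 1 (b + c + d) (a * p / b + a * p / c + a * p / d) (p ^ i)‖ ≤ C := by
  simp only [prod_jacksonNum_div_jacksonDen hb hc hd h]
  obtain ⟨C, -, hC⟩ := exists_norm_le_of_tendsto
    ((((tendsto_qPoch b hp).mul (tendsto_qPoch c hp)).mul (tendsto_qPoch d hp)).div
      (((tendsto_qPoch _ hp).mul (tendsto_qPoch _ hp)).mul (tendsto_qPoch _ hp))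
      (mul_ne_zero (mul_ne_zero (qPochInf_ne_zero hp hb') (qPochInf_ne_zero hp hc'))
        (qPochInf_ne_zero hp hd')))
  exact ⟨C, hC⟩

end ThreeParameters

section InfiniteParameters

variable {a p : ℂ}

theorem prod_neg_mul_pow (a p : ℂ) (n : ℕ) :
    ∏ i ∈ range n, -(a * p ^ i) = (-1) ^ n * a ^ n * p ^ n.choose 2 := by
  induction n with
  | zero => simp
  | succ n ih =>
    rw [prod_range_succ, ih, Nat.choose_succ_succ' n 1, Nat.choose_one_right, pow_add p]
    ring

theorem jacksonDen_zero_zero_one (a p x : ℂ) : jacksonDen a p 0 0 1 x = -x := by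
  simp [jacksonDen]

theorem prod_jacksonNum_div_jacksonDen_zero_zero_one (hp : p ≠ 0) (m : ℕ) :
    ∏ i ∈ range m, jacksonNum a p 0 0 1 (p ^ i) / jacksonDen a p 0 0 1 (p ^ i)
      = (-1) ^ m * a ^ m * p ^ m.choose 2 := by
  rw [← prod_neg_mul_pow]
  refine prod_congr rfl fun i _ => ?_
  have := pow_ne_zero i hp
  rw [jacksonNum, jacksonDen_zero_zero_one]
  field_simp
  ring

theorem jacksonSum_zero_zero_one (ha : a ≠ 0) (hp : p ≠ 0) (n : ℕ) :
    jacksonSum a p 0 0 1 n = (-1) ^ n * (1 / a) ^ n * p ^ n.choose 2 := by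
  rw [← prod_neg_mul_pow, jacksonSum]
  refine prod_congr rfl fun i _ => ?_
  have := pow_ne_zero i hp
  rw [jacksonNum, jacksonDen_zero_zero_one]
  field_simp
  ring

theorem exists_norm_prod_jacksonNum_div_jacksonDen_zero_zero_one_le (ha : a ≠ 0) (hp0 : p ≠ 0)
    (hp : ‖p‖ < 1) :
    ∃ C : ℝ, ∀ m : ℕ,
      ‖∏ i ∈ range m, jacksonNum a p 0 0 1 (p ^ i) / jacksonDen a p 0 0 1 (p ^ i)‖ ≤ C := by
  simp only [prod_jacksonNum_div_jacksonDen_zero_zero_one hp0]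
  have h := (summable_norm_pow_choose_two_mul_pow hp0 hp (neg_ne_zero.2 ha)).of_norm
  obtain ⟨C, -, hC⟩ := exists_norm_le_of_tendsto h.tendsto_atTop_zero
  refine ⟨C, fun m => (congrArg norm ?_).trans_le (hC m)⟩
  rw [neg_pow]
  ring

end InfiniteParameters

section Representations

variable {q e s t : ℂ}

theorem cubicTheta_eq_of_jackson (hq0 : q ≠ 0) (hq : ‖q‖ < 1)
    (hden : ∀ i : ℕ, jacksonDen (1 / q) (q ^ 3) e s t ((q ^ 3) ^ i) ≠ 0)
    (hprod : ∃ C : ℝ, ∀ m : ℕ, ‖∏ i ∈ range m,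
      jacksonNum (1 / q) (q ^ 3) e s t ((q ^ 3) ^ i)
        / jacksonDen (1 / q) (q ^ 3) e s t ((q ^ 3) ^ i)‖ ≤ C) :
    (Summable fun n : ℕ+ =>
      jacksonSum (1 / q) (q ^ 3) e s t n * q ^ (n : ℕ) / (1 - (q ^ 3) ^ (n : ℕ))) ∧
    (Summable fun m : ℕ+ => jacksonFactor (1 / q) (q ^ 3) e s t m * ((q ^ 2) ^ (m : ℕ)
      * qPoch (q ^ 3) (q ^ 3) (2 * m - 1) / qPoch q (q ^ 3) (2 * m))) ∧
    cubicTheta q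
      = 1 + 6 * ∑' n : ℕ+,
          jacksonSum (1 / q) (q ^ 3) e s t n * q ^ (n : ℕ) / (1 - (q ^ 3) ^ (n : ℕ))
        - 6 * ∑' m : ℕ+, jacksonFactor (1 / q) (q ^ 3) e s t m * ((q ^ 2) ^ (m : ℕ)
          * qPoch (q ^ 3) (q ^ 3) (2 * m - 1) / qPoch q (q ^ 3) (2 * m)) := by
  have hp := norm_pow_lt_one hq three_ne_zero
  have hap : 1 / q * q ^ 3 = q ^ 2 := by field_simp
  have hz : (1 / q) ^ 2 * q ^ 3 = q := by field_simp
  have ha1 : 1 - 1 / q ≠ 0 := by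
    intro h
    rw [one_div, sub_eq_zero, eq_comm, inv_eq_one] at h
    simp [h] at hq
  have transformation := jackson_transformation (one_div_ne_zero hq0) ha1 hp
    (hap ▸ norm_pow_lt_one hq two_ne_zero) (hz.symm ▸ hq) hden
    (exists_norm_jacksonFactor_le hp hprod)
  rw [hap, hz, one_div_one_div] at transformation
  obtain ⟨summable_fst, summable_snd, h⟩ := transformation
  refine ⟨summable_fst, summable_snd, ?_⟩
  rw [h, cubicTheta_eq_tsum_gaussLogTerm hq0 hq]
  ring

theorem pow_six_mul_sub_one (hq0 : q ≠ 0) (n : ℕ+) :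
    q ^ (6 * (n : ℕ) - 1) = 1 / q * (q ^ 3) ^ (2 * (n : ℕ)) := by
  have := n.pos
  rw [one_div_mul_eq_div, eq_div_iff hq0, ← pow_succ, ← pow_mul]
  congr 1
  omega

theorem cubicTheta_eq_seriesOne (hq0 : q ≠ 0) (hq : ‖q‖ < 1) :
    Summable (seriesOne q) ∧ cubicTheta q = 1 + 6 * ∑' n : ℕ+, seriesOne q n := by
  have hp := norm_pow_lt_one hq three_ne_zero
  have hc := one_sub_mul_pow_ne_zero (norm_pow_lt_one hq two_ne_zero) hp.le
  have term (j : ℕ) : gaussLogTerm q q (q ^ 3) j = seriesOne q j.succPNat := by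
    rw [seriesOne, gaussLogTerm, Nat.succPNat_coe, Nat.succ_eq_add_one, pow_mul, ← sq,
      div_mul_eq_mul_div, div_div]
  have summable := summable_gaussLogTerm q hp hq (by simpa only [sq] using hc)
  have h := cubicTheta_eq_tsum_gaussLogTerm hq0 hq
  rw [funext term] at summable
  rw [funext term] at h
  refine ⟨Equiv.pnatEquivNat.symm.summable_iff.1 summable, ?_⟩
  rw [h]
  exact congrArg _ (congrArg _ (Equiv.pnatEquivNat.symm.tsum_eq (seriesOne q)))

theorem mul_mul_div_eq_one_div_sq_mul (hq0 : q ≠ 0) {ρ₁ ρ₂ : ℂ} (h1 : ρ₁ ≠ 0) (h2 : ρ₂ ≠ 0) :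
    ρ₁ * ρ₂ * (q / (ρ₁ * ρ₂)) = (1 / q) ^ 2 * q ^ 3 := by
  field_simp

theorem seriesThreeFst_eq (hq0 : q ≠ 0) {ρ₁ ρ₂ : ℂ} (h1 : ρ₁ ≠ 0) (h2 : ρ₂ ≠ 0) (n : ℕ+) :
    seriesThreeFst q ρ₁ ρ₂ n
      = jacksonSum (1 / q) (q ^ 3) 1 (ρ₁ + ρ₂ + q / (ρ₁ * ρ₂))
          (1 / q * q ^ 3 / ρ₁ + 1 / q * q ^ 3 / ρ₂ + 1 / q * q ^ 3 / (q / (ρ₁ * ρ₂))) n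
        * q ^ (n : ℕ) / (1 - (q ^ 3) ^ (n : ℕ)) := by
  have h3 : q / (ρ₁ * ρ₂) ≠ 0 := div_ne_zero hq0 (mul_ne_zero h1 h2)
  have hap : 1 / q * q ^ 3 = q ^ 2 := by field_simp
  have hap3 : q ^ 2 / (q / (ρ₁ * ρ₂)) = ρ₁ * ρ₂ * q := by field_simp
  have hd : q / (ρ₁ * ρ₂) / (1 / q) = q ^ 2 / (ρ₁ * ρ₂) := by field_simp
  rw [jacksonSum_eq_div h1 h2 h3 (mul_mul_div_eq_one_div_sq_mul hq0 h1 h2), hap, hap3, hd,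
    one_div, div_inv_eq_mul, div_inv_eq_mul, div_mul_eq_mul_div, div_div, ← pow_mul,
    seriesThreeFst]

theorem seriesThreeSnd_eq (hq0 : q ≠ 0) {ρ₁ ρ₂ : ℂ} (h1 : ρ₁ ≠ 0) (h2 : ρ₂ ≠ 0) (n : ℕ+) :
    seriesThreeSnd q ρ₁ ρ₂ n
      = jacksonFactor (1 / q) (q ^ 3) 1 (ρ₁ + ρ₂ + q / (ρ₁ * ρ₂))
          (1 / q * q ^ 3 / ρ₁ + 1 / q * q ^ 3 / ρ₂ + 1 / q * q ^ 3 / (q / (ρ₁ * ρ₂))) n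
        * ((q ^ 2) ^ (n : ℕ) * qPoch (q ^ 3) (q ^ 3) (2 * n - 1) / qPoch q (q ^ 3) (2 * n)) := by
  have h3 : q / (ρ₁ * ρ₂) ≠ 0 := div_ne_zero hq0 (mul_ne_zero h1 h2)
  have hap : 1 / q * q ^ 3 = q ^ 2 := by field_simp
  have hap3 : q ^ 2 / (q / (ρ₁ * ρ₂)) = ρ₁ * ρ₂ * q := by field_simp
  rw [jacksonFactor, jacksonCoeff, prod_jacksonNum_div_jacksonDen h1 h2 h3
    (mul_mul_div_eq_one_div_sq_mul hq0 h1 h2), hap, hap3, ← pow_mul, seriesThreeSnd,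
    pow_six_mul_sub_one hq0]
  simp only [div_eq_mul_inv, mul_inv]
  ring

theorem cubicTheta_eq_seriesThree (hq0 : q ≠ 0) (hq : ‖q‖ < 1) {ρ₁ ρ₂ : ℂ} (h1 : ρ₁ ≠ 0)
    (h2 : ρ₂ ≠ 0)
    (h : ∀ j : ℕ, ρ₁ ≠ q ^ (3 * j + 2) ∧ ρ₂ ≠ q ^ (3 * j + 2) ∧
      ρ₁ * ρ₂ * q ^ (3 * j + 1) ≠ 1) :
    Summable (seriesThreeFst q ρ₁ ρ₂) ∧ Summable (seriesThreeSnd q ρ₁ ρ₂) ∧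
      cubicTheta q = 1 + 6 * ∑' n : ℕ+, seriesThreeFst q ρ₁ ρ₂ n
        - 6 * ∑' n : ℕ+, seriesThreeSnd q ρ₁ ρ₂ n := by
  have h3 : q / (ρ₁ * ρ₂) ≠ 0 := div_ne_zero hq0 (mul_ne_zero h1 h2)
  have hbcd := mul_mul_div_eq_one_div_sq_mul hq0 h1 h2
  have hap : 1 / q * q ^ 3 = q ^ 2 := by field_simp
  have hap3 : q ^ 2 / (q / (ρ₁ * ρ₂)) = ρ₁ * ρ₂ * q := by field_simp
  have den_fst (i : ℕ) : 1 - 1 / q * q ^ 3 / ρ₁ * (q ^ 3) ^ i ≠ 0 := fun hi => (h i).1 <| by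
    rw [hap] at hi
    field_simp at hi
    linear_combination hi
  have den_snd (i : ℕ) : 1 - 1 / q * q ^ 3 / ρ₂ * (q ^ 3) ^ i ≠ 0 := fun hi => (h i).2.1 <| by
    rw [hap] at hi
    field_simp at hi
    linear_combination hi
  have den_thd (i : ℕ) : 1 - 1 / q * q ^ 3 / (q / (ρ₁ * ρ₂)) * (q ^ 3) ^ i ≠ 0 :=
    fun hi => (h i).2.2 <| by
      rw [hap, hap3] at hi
      linear_combination -hi
  simp only [funext (seriesThreeFst_eq hq0 h1 h2), funext (seriesThreeSnd_eq hq0 h1 h2)]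
  refine cubicTheta_eq_of_jackson hq0 hq (fun i => ?_)
    (exists_norm_prod_jacksonNum_div_jacksonDen_le (norm_pow_lt_one hq three_ne_zero) h1 h2 h3
      hbcd den_fst den_snd den_thd)
  rw [jacksonDen_eq_mul h1 h2 h3 hbcd]
  exact mul_ne_zero (mul_ne_zero (den_fst i) (den_snd i)) (den_thd i)

theorem seriesThreeFst_one_div_self (hq0 : q ≠ 0) (n : ℕ+) : seriesThreeFst q (1 / q) q n = 0 := by
  have h : qPoch 1 (q ^ 3) n = 0 := prod_eq_zero (mem_range.2 n.pos) (by simp)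
  rw [seriesThreeFst, one_div_mul_cancel hq0, h]
  simp

theorem seriesThreeSnd_one_div_self (hq0 : q ≠ 0) (hq : ‖q‖ < 1) (n : ℕ+) :
    seriesThreeSnd q (1 / q) q n = seriesTwo q n := by
  have hp := norm_pow_lt_one hq three_ne_zero
  have hn := qPoch_ne_zero (one_sub_mul_pow_ne_zero hq hp.le) n
  have h1 : q ^ 2 / (1 / q) = q ^ 3 := by field_simp
  have h2 : q ^ 2 / q = q := by field_simp
  rw [seriesThreeSnd, seriesTwo, one_div_mul_cancel hq0, h1, h2, div_one, one_mul]
  refine Eq.trans ?_ (mul_div_mul_left _ _ (mul_ne_zero hn hn))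
  congr 1 <;> ring

theorem cubicTheta_eq_seriesTwo (hq0 : q ≠ 0) (hq : ‖q‖ < 1) :
    Summable (seriesTwo q) ∧ cubicTheta q = 1 - 6 * ∑' n : ℕ+, seriesTwo q n := by
  obtain ⟨-, summable, h⟩ := cubicTheta_eq_seriesThree hq0 hq (one_div_ne_zero hq0) hq0 fun j => by
    refine ⟨fun h => one_sub_pow_succ_ne_zero hq (3 * j + 2) ?_,
      fun h => one_sub_pow_succ_ne_zero hq (3 * j) (mul_left_cancel₀ hq0 ?_),
      fun h => one_sub_pow_succ_ne_zero hq (3 * j) ?_⟩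
    · rw [pow_succ, ← h, one_div_mul_cancel hq0, sub_self]
    · linear_combination h
    · rw [one_div_mul_cancel hq0, one_mul] at h
      rw [h, sub_self]
  simp only [funext (seriesThreeSnd_one_div_self hq0 hq), seriesThreeFst_one_div_self hq0,
    tsum_zero, mul_zero, add_zero] at summable h
  exact ⟨summable, h⟩

theorem two_mul_choose_two_add (n : ℕ) : 2 * n.choose 2 + n = n ^ 2 := by
  have := two_mul_chooseTwo n
  rw [← natCast_choose_two] at this
  zify
  linear_combination this

theorem seriesFourFst_eq (hq0 : q ≠ 0) (n : ℕ+) :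
    seriesFourFst q n = jacksonSum (1 / q) (q ^ 3) 0 0 1 n * q ^ (n : ℕ)
      / (1 - (q ^ 3) ^ (n : ℕ)) := by
  have h : (3 * (n : ℕ) ^ 2 + n) / 2 = n + n + 3 * (n : ℕ).choose 2 := by
    have := two_mul_choose_two_add n
    omega
  rw [jacksonSum_zero_zero_one (one_div_ne_zero hq0) (pow_ne_zero 3 hq0), one_div_one_div,
    seriesFourFst, h, ← pow_mul, ← pow_mul, pow_add, pow_add]
  ring

theorem seriesFourSnd_eq (hq0 : q ≠ 0) (n : ℕ+) :
    seriesFourSnd q n = jacksonFactor (1 / q) (q ^ 3) 0 0 1 n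
      * ((q ^ 2) ^ (n : ℕ) * qPoch (q ^ 3) (q ^ 3) (2 * n - 1) / qPoch q (q ^ 3) (2 * n)) := by
  have h : (3 * (n : ℕ) ^ 2 - n) / 2 = n + 3 * (n : ℕ).choose 2 := by
    have := two_mul_choose_two_add n
    omega
  have h_pow : (1 / q) ^ (n : ℕ) * (q ^ 2) ^ (n : ℕ) = q ^ (n : ℕ) := by
    rw [← mul_pow]
    congr 1
    field_simp
  rw [jacksonFactor, jacksonCoeff,
    prod_jacksonNum_div_jacksonDen_zero_zero_one (pow_ne_zero 3 hq0), seriesFourSnd,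
    pow_six_mul_sub_one hq0, h, pow_add q n, ← h_pow, pow_mul q 3 ((n : ℕ).choose 2)]
  simp only [div_eq_mul_inv, mul_inv]
  ring

theorem cubicTheta_eq_seriesFour (hq0 : q ≠ 0) (hq : ‖q‖ < 1) :
    Summable (seriesFourFst q) ∧ Summable (seriesFourSnd q) ∧
      cubicTheta q = 1 + 6 * ∑' n : ℕ+, seriesFourFst q n
        - 6 * ∑' n : ℕ+, seriesFourSnd q n := by
  have hp0 : q ^ 3 ≠ 0 := pow_ne_zero 3 hq0
  simp only [funext (seriesFourFst_eq hq0), funext (seriesFourSnd_eq hq0)]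
  refine cubicTheta_eq_of_jackson hq0 hq (fun i => ?_)
    (exists_norm_prod_jacksonNum_div_jacksonDen_zero_zero_one_le (one_div_ne_zero hq0) hp0
      (norm_pow_lt_one hq three_ne_zero))
  rw [jacksonDen_zero_zero_one]
  exact neg_ne_zero.2 (pow_ne_zero i hp0)

end Representations

/-- For `0 < |q| < 1` all the series involved converge, and `a(q)` has the four representations;
in the third one `ρ₁, ρ₂` are arbitrary nonzero parameters for which no denominator vanishes. -/
theorem corollary4 (q : ℂ) (hq0 : 0 < ‖q‖) (hq1 : ‖q‖ < 1) :
    Summable (cubicThetaTerm q) ∧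
    (Summable (seriesOne q) ∧
      cubicTheta q = 1 + 6 * ∑' n : ℕ+, seriesOne q n) ∧
    (Summable (seriesTwo q) ∧
      cubicTheta q = 1 - 6 * ∑' n : ℕ+, seriesTwo q n) ∧
    (∀ ρ₁ ρ₂ : ℂ, ρ₁ ≠ 0 → ρ₂ ≠ 0 →
      (∀ j : ℕ, ρ₁ ≠ q ^ (3 * j + 2) ∧ ρ₂ ≠ q ^ (3 * j + 2) ∧
        ρ₁ * ρ₂ * q ^ (3 * j + 1) ≠ 1) →
      Summable (seriesThreeFst q ρ₁ ρ₂) ∧ Summable (seriesThreeSnd q ρ₁ ρ₂) ∧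
      cubicTheta q = 1 + 6 * ∑' n : ℕ+, seriesThreeFst q ρ₁ ρ₂ n
        - 6 * ∑' n : ℕ+, seriesThreeSnd q ρ₁ ρ₂ n) ∧
    (Summable (seriesFourFst q) ∧ Summable (seriesFourSnd q) ∧
      cubicTheta q = 1 + 6 * ∑' n : ℕ+, seriesFourFst q n
        - 6 * ∑' n : ℕ+, seriesFourSnd q n) := by
  have hq : q ≠ 0 := norm_pos_iff.1 hq0
  exact ⟨summable_cubicThetaTerm hq hq1, cubicTheta_eq_seriesOne hq hq1,
    cubicTheta_eq_seriesTwo hq hq1,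
    fun _ _ h1 h2 h => cubicTheta_eq_seriesThree hq hq1 h1 h2 h,
    cubicTheta_eq_seriesFour hq hq1⟩
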